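/- Let $H$ be a finite simple graph. For $k\ge 0$, $H$ is $k$-degenerate if every nonempty subgraph of $H$ contains a vertex of degree at most $k$ in that subgraph; the degeneracy $d$ of $H$ is the least such $k$. The depth $\Delta$ of $H$ is the least $r$ for which there is an acyclic orientation of $H$ with maximum outdegree at most $d$ in which every directed path has length at most $r$ (a path with $n+1$ vertices has length $n$). For $p\in(0,1)$ let $G(\infty,p)$ be the random graph on the vertex set $\mathbb N$ in which each pair of vertices is an edge independently with probability $p$. Let $f(H,p)$ be the least $N$ for which some adaptive strategy, making at most $N$ queries of the form "is $uv$ an edge?" to $G\sim G(\infty,p)$, finds a copy of $H$ with probability at least $\tfrac12$; that is, with probability at least $\tfrac12$ the queried pairs that turn out to be edges contain a (not necessarily induced) copy of $H$. Let $\log_t$ denote the $t$-fold iterated natural logarithm. Theorem. Let $H$ be a finite graph with degeneracy $d\ge 2$ and depth $\Delta\ge 1$. Then, as $p\to 0^+$, $$f(H,p)=O_H\!\left(\frac{p^{-d}\,\log_{\Delta+1}(1/p)}{\log_{\Delta}(1/p)}\right),$$ that is, there are constants $C,p_0>0$ depending only on $H$ such that for all $0<p<\min(p_0,1)$ the number $f(H,p)$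 is finite and at most $C\,p^{-d}\log_{\Delta+1}(1/p)/\log_\Delta(1/p)$. In particular, $f(H,p)=o(p^{-d})$ as $p\to0^+$ for every such $H$. -/

import Mathlib

open scoped unitInterval

namespace SubgraphQuery

section Degeneracy

variable {V : Type*}

/-- `H` is `k`-degenerate: every (nonempty) subgraph of `H` contains a vertex whose degree in that
subgraph is at most `k`. -/
def IsDegenerate (H : SimpleGraph V) (k : ℕ) : Prop :=
  ∀ S : H.Subgraph, S.verts.Nonempty → ∃ v ∈ S.verts, (S.neighborSet v).ncard ≤ k

/-- The degeneracy of a (finite) graph: the least `k` for which it is `k`-degenerate. -/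
noncomputable def degeneracy (H : SimpleGraph V) : ℕ :=
  sInf {k | IsDegenerate H k}

/-- `D` is an acyclic orientation of `H`: forgetting directions gives `H`, and there is no directed
closed walk of positive length (in particular no loop and no edge directed both ways). -/
def IsAcyclicOrientation (D : Digraph V) (H : SimpleGraph V) : Prop :=
  (∀ u v, H.Adj u v ↔ D.Adj u v ∨ D.Adj v u) ∧ ∀ v, ¬ Relation.TransGen D.Adj v v

/-- All outdegrees of `D` are at most `k`. -/
def OutdegreeLE (D : Digraph V) (k : ℕ) : Prop :=
  ∀ v, {w | D.Adj v w}.ncard ≤ k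

/-- All directed paths of `D` have length at most `r`, where a path on `n + 1` vertices has
length `n`. -/
def PathLengthLE (D : Digraph V) (r : ℕ) : Prop :=
  ∀ l : List V, l.IsChain D.Adj → l.Nodup → l.length ≤ r + 1

/-- The depth of a (finite) graph `H`: the least `r` such that some acyclic orientation of `H` has
maximum outdegree at most the degeneracy of `H` and all directed paths of length at most `r`. -/
noncomputable def depth (H : SimpleGraph V) : ℕ :=
  sInf {r | ∃ D : Digraph V,
    IsAcyclicOrientation D H ∧ OutdegreeLE D (degeneracy H) ∧ PathLengthLE D r}

end Degeneracy

/-- An adaptive querying strategy on the vertex set `ℕ`, as a decision tree: either halt, or ask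
whether `u` and `v` are adjacent and continue with `no` or `yes` according to the answer. -/
inductive Strategy : Type
  | done : Strategy
  | query (u v : ℕ) (no yes : Strategy) : Strategy

namespace Strategy

/-- The number of queries made in the worst case. -/
def cost : Strategy → ℕ
  | done => 0
  | query _ _ no yes => max no.cost yes.cost + 1

open Classical in
/-- The set of edges revealed (queries answered positively) when the strategy is run on `G`. -/
noncomputable def revealed (G : SimpleGraph ℕ) : Strategy → Set (Sym2 ℕ)
  | done => ∅
  | query u v no yes =>
      if G.Adj u v then insert s(u, v) (yes.revealed G) else no.revealed G

/-- Run on `G`, the strategy finds a copy of `H`: the revealed edges contain a (not necessarily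
induced) copy of `H`. -/
def Finds {V : Type*} (T : Strategy) (H : SimpleGraph V) (G : SimpleGraph ℕ) : Prop :=
  H.IsContained (SimpleGraph.fromEdgeSet (T.revealed G))

end Strategy

/-- `f(H, p)`: the least number of queries with which some adaptive strategy finds a copy of `H` in
the random graph `G(∞, p)` on `ℕ` with probability at least `1/2` (`⊤` if there is none). -/
noncomputable def queryComplexity {V : Type*} (H : SimpleGraph V) (p : I) : ℕ∞ :=
  ⨅ (T : Strategy)
    (_ : 1 / 2 ≤ SimpleGraph.binomialRandom ℕ p {G : SimpleGraph ℕ | T.Finds H G}),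
    (T.cost : ℕ∞)

end SubgraphQuery

namespace SubgraphQuery

open MeasureTheory ProbabilityTheory

/-! ### Bernoulli sums over finite sets -/

/-! Split ℕ into infinite blocks, one for each vertex of H, and embed H along an acyclic orientation
of outdegree at most d and path length at most Δ, placing every vertex after its outneighbours.
Write i for the level of a vertex, the length of a longest directed path leaving it. A vertex whose
outneighbours are all placed holds a reservoir of k_i ≈ √(log_i(1/p)) possible images, already
joined to the images of its outneighbours.

To place z of level i, consider the vertices w for which z is the last unplaced outneighbour. For
each of them, M ≈ 4p^{-d}/log_Δ(1/p) vertices of its block are tested against the at most d-1 other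
outneighbours, which leaves L ≈ p^{-1}/log_Δ(1/p) common neighbours (`achieves_common_neighbors`). A
typical candidate for z has on average only pL < 1 neighbours among these; the gain over p^{-d}
comes from using an atypical one. Put s = log_{i+1}(1/p). Cut the L vertices into k_{i+1} ≈ √s
groups. A candidate hits all groups, for all w, with probability at least exp(-O(√s log s)), and
there are k_i ≈ exp(s/2) candidates, so one of them very likely succeeds (`achieves_good_image`,
`one_sub_pow_pow_le`). Each w has level at least i+1 and k is decreasing, so the hits refill its
reservoir.

The first kind of query dominates the cost, since the second needs only O(k_0 L) queries and d ≥ 2.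
This bounds f by O(p^{-d}/log_Δ(1/p)), even without the factor log_{Δ+1}(1/p). All queries are
fresh, so the success probabilities of successive stages multiply (`Achieves.bind`);
`exists_strategy` iterates the step `achieves_extend`, and `exists_parameters` chooses the numbers.
-/

/-- The expectation of `f S` for the random subset `S` of `Q` that contains each element
independently with probability `p`. -/
noncomputable def bernoulliSum {α : Type*} [DecidableEq α] (p : ℝ) (Q : Finset α)
    (f : Finset α → ℝ) : ℝ :=
  ∑ S ∈ Q.powerset, p ^ S.card * (1 - p) ^ (Q.card - S.card) * f S

section BernoulliSum

variable {α : Type*} [DecidableEq α] {p : ℝ}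

theorem bernoulliSum_empty (f : Finset α → ℝ) : bernoulliSum p ∅ f = f ∅ := by
  simp [bernoulliSum]

theorem bernoulliSum_insert {e : α} {Q : Finset α} (he : e ∉ Q) (f : Finset α → ℝ) :
    bernoulliSum p (insert e Q) f =
      p * bernoulliSum p Q (fun S => f (insert e S)) + (1 - p) * bernoulliSum p Q f := by
  unfold bernoulliSum
  rw [Finset.sum_powerset_insert he, Finset.mul_sum, Finset.mul_sum, add_comm]
  congr 1
  · refine Finset.sum_congr rfl fun S hS => ?_
    have hS' := Finset.mem_powerset.1 hS
    rw [Finset.card_insert_of_notMem he, Finset.card_insert_of_notMem fun h => he (hS' h)]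
    rw [Nat.add_sub_add_right]
    ring
  · refine Finset.sum_congr rfl fun S hS => ?_
    have hS' := Finset.card_le_card (Finset.mem_powerset.1 hS)
    rw [Finset.card_insert_of_notMem he, Nat.sub_add_comm hS']
    ring

theorem bernoulliSum_congr {Q : Finset α} {f g : Finset α → ℝ} (h : ∀ S ⊆ Q, f S = g S) :
    bernoulliSum p Q f = bernoulliSum p Q g :=
  Finset.sum_congr rfl fun S hS => by rw [h S (Finset.mem_powerset.1 hS)]

theorem bernoulliSum_mono (hp0 : 0 ≤ p) (hp1 : p ≤ 1) {Q : Finset α} {f g : Finset α → ℝ}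
    (h : ∀ S ⊆ Q, f S ≤ g S) : bernoulliSum p Q f ≤ bernoulliSum p Q g := by
  refine Finset.sum_le_sum fun S hS => ?_
  have h1 : 0 ≤ 1 - p := by linarith
  exact mul_le_mul_of_nonneg_left (h S (Finset.mem_powerset.1 hS)) (by positivity)

theorem bernoulliSum_const (Q : Finset α) (c : ℝ) : bernoulliSum p Q (fun _ => c) = c := by
  induction Q using Finset.induction_on with
  | empty => simp [bernoulliSum]
  | insert e Q he ih => rw [bernoulliSum_insert he, ih]; ring

theorem bernoulliSum_one_sub (Q : Finset α) (f : Finset α → ℝ) :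
    bernoulliSum p Q (fun S => 1 - f S) = 1 - bernoulliSum p Q f := by
  rw [eq_sub_iff_add_eq]
  refine Eq.trans ?_ (bernoulliSum_const (p := p) Q 1)
  simp only [bernoulliSum, ← Finset.sum_add_distrib]
  exact Finset.sum_congr rfl fun S _ => by ring

theorem bernoulliSum_const_mul (Q : Finset α) (c : ℝ) (f : Finset α → ℝ) :
    bernoulliSum p Q (fun S => c * f S) = c * bernoulliSum p Q f := by
  simp only [bernoulliSum, Finset.mul_sum]
  exact Finset.sum_congr rfl fun S _ => by ring

open Classical in
theorem bernoulliSum_subset (Q : Finset α) :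
    bernoulliSum p Q (fun S => if Q ⊆ S then 1 else 0) = p ^ Q.card := by
  unfold bernoulliSum
  rw [Finset.sum_eq_single Q]
  · simp
  · intro S hS hne
    simp [mt (Finset.Subset.antisymm (Finset.mem_powerset.1 hS)) hne]
  · simp

open Classical in
theorem bernoulliSum_eq_empty (Q : Finset α) :
    bernoulliSum p Q (fun S => if S = ∅ then 1 else 0) = (1 - p) ^ Q.card := by
  unfold bernoulliSum
  rw [Finset.sum_eq_single ∅]
  · simp
  · intro S _ hne
    simp [hne]
  · simp

/-- Independence of the traces of the random set on disjoint sets. -/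
theorem bernoulliSum_union_mul {Q R : Finset α} (h : Disjoint Q R) (f g : Finset α → ℝ) :
    bernoulliSum p (Q ∪ R) (fun S => f (S ∩ Q) * g (S ∩ R)) =
      bernoulliSum p Q f * bernoulliSum p R g := by
  induction Q using Finset.induction_on generalizing f with
  | empty =>
    rw [Finset.empty_union, bernoulliSum_empty, ← bernoulliSum_const_mul]
    exact bernoulliSum_congr fun S hS => by
      rw [Finset.inter_empty, Finset.inter_eq_left.2 hS]
  | insert e Q he ih =>
    rw [Finset.disjoint_insert_left] at h
    have he' : e ∉ Q ∪ R := by simp [he, h.1]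
    rw [Finset.insert_union, bernoulliSum_insert he', bernoulliSum_insert he, add_mul, mul_assoc,
      mul_assoc, ← ih h.2, ← ih h.2]
    congr 2
    · refine bernoulliSum_congr fun S hS => ?_
      congr 2
      · rw [Finset.insert_inter_distrib]
      · rw [Finset.insert_inter_of_notMem h.1]
    · refine bernoulliSum_congr fun S hS => ?_
      rw [Finset.inter_insert_of_notMem fun h => he' (hS h)]

theorem bernoulliSum_biUnion_prod {ι : Type*} (J : Finset ι) (Q : ι → Finset α)
    (hQ : (J : Set ι).PairwiseDisjoint Q) (f : ι → Finset α → ℝ) :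
    bernoulliSum p (J.biUnion Q) (fun S => ∏ i ∈ J, f i (S ∩ Q i)) =
      ∏ i ∈ J, bernoulliSum p (Q i) (f i) := by
  classical
  induction J using Finset.induction_on with
  | empty => simp [bernoulliSum_empty]
  | insert i J hi ih =>
    have hd : Disjoint (Q i) (J.biUnion Q) := by
      rw [Finset.disjoint_biUnion_right]
      intro j hj
      exact hQ (by simp) (by simp [hj]) fun h => hi (h ▸ hj)
    rw [Finset.prod_insert hi, ← ih (hQ.subset (by simp)), ← bernoulliSum_union_mul hd,
      Finset.biUnion_insert]
    refine bernoulliSum_congr fun S _ => ?_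
    rw [Finset.prod_insert hi]
    congr 1
    refine Finset.prod_congr rfl fun j hj => ?_
    rw [Finset.inter_assoc, Finset.inter_eq_right.2 (Finset.subset_biUnion_of_mem Q hj)]

end BernoulliSum

/-! ### Strategies without repeated queries -/

/-- Started when the pairs in `F` have already been queried, the strategy never repeats a query
and never queries a loop. -/
def Strategy.Fresh : Strategy → Finset (Sym2 ℕ) → Prop
  | .done, _ => True
  | .query u v no yes, F =>
      u ≠ v ∧ s(u, v) ∉ F ∧ no.Fresh (insert s(u, v) F) ∧ yes.Fresh (insert s(u, v) F)

open Classical in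
/-- The probability that a strategy started with queried pairs `F` and revealed edges `E` ends in
a state satisfying `g`, when every query is answered positively with probability `p`. -/
noncomputable def Strategy.value (p : ℝ) (g : Finset (Sym2 ℕ) → Finset (Sym2 ℕ) → Prop) :
    Strategy → Finset (Sym2 ℕ) → Finset (Sym2 ℕ) → ℝ
  | .done, F, E => if g F E then 1 else 0
  | .query u v no yes, F, E =>
      p * yes.value p g (insert s(u, v) F) (insert s(u, v) E) +
        (1 - p) * no.value p g (insert s(u, v) F) E

theorem Strategy.value_nonneg {p : ℝ} (hp0 : 0 ≤ p) (hp1 : p ≤ 1)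
    (g : Finset (Sym2 ℕ) → Finset (Sym2 ℕ) → Prop) (T : Strategy) (F E : Finset (Sym2 ℕ)) :
    0 ≤ T.value p g F E := by
  induction T generalizing F E with
  | done => unfold Strategy.value; split_ifs <;> norm_num
  | query u v no yes hno hyes =>
    have h1 : 0 ≤ 1 - p := by linarith
    have := hno (insert s(u, v) F) E
    have := hyes (insert s(u, v) F) (insert s(u, v) E)
    unfold Strategy.value
    positivity

theorem Strategy.value_mono {p : ℝ} (hp0 : 0 ≤ p) (hp1 : p ≤ 1)
    {g g' : Finset (Sym2 ℕ) → Finset (Sym2 ℕ) → Prop} (h : ∀ F E, g F E → g' F E)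
    (T : Strategy) (F E : Finset (Sym2 ℕ)) : T.value p g F E ≤ T.value p g' F E := by
  induction T generalizing F E with
  | done =>
    unfold Strategy.value
    by_cases hg : g F E
    · simp [hg, h F E hg]
    · rw [if_neg hg]; split_ifs <;> norm_num
  | query u v no yes hno hyes =>
    have h1 : 0 ≤ 1 - p := by linarith
    exact add_le_add (mul_le_mul_of_nonneg_left (hyes _ _) hp0)
      (mul_le_mul_of_nonneg_left (hno _ _) h1)

/-- The graphs in which the pairs of `E` are edges and those of `F \ E` are not. -/
def cylinder (F E : Finset (Sym2 ℕ)) : Set (SimpleGraph ℕ) :=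
  {G | ∀ e ∈ F, e ∈ G.edgeSet ↔ e ∈ E}

theorem binomialRandom_cylinder (p : I) {F E : Finset (Sym2 ℕ)} (hE : E ⊆ F)
    (hF : ∀ e ∈ F, ¬ e.IsDiag) :
    SimpleGraph.binomialRandom ℕ p (cylinder F E) =
      ENNReal.ofReal ((p : ℝ) ^ E.card * (1 - p) ^ (F \ E).card) := by
  classical
  have h0 : (0 : ℝ) ≤ p := p.2.1
  have h1 : (0 : ℝ) ≤ 1 - p := sub_nonneg.2 p.2.2
  have hmeas : MeasurableSet (cylinder F E) := by
    have : cylinder F E = ⋂ e ∈ F, {G : SimpleGraph ℕ | e ∈ G.edgeSet ↔ e ∈ E} := by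
      ext G; simp [cylinder]
    rw [this]
    refine Finset.measurableSet_biInter F fun e _ => ?_
    by_cases he : e ∈ E
    · simp only [he, iff_true]
      exact measurableSet_setOfPred.2 (by fun_prop)
    · simp only [he, iff_false]
      exact measurableSet_setOfPred.2 (by fun_prop)
  rw [SimpleGraph.binomialRandom_eq_map, Measure.map_apply (by fun_prop) hmeas,
    setBernoulli_apply']
  have : (fun p : Sym2 ℕ → Prop => {i | p i}) ⁻¹' (SimpleGraph.fromEdgeSet ⁻¹' cylinder F E) =
      Set.pi (F : Set (Sym2 ℕ)) fun e => {e ∈ E} := by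
    ext P
    simp only [cylinder, Set.mem_preimage, Set.mem_ofPred_eq, SimpleGraph.edgeSet_fromEdgeSet,
      Set.mem_pi, Finset.mem_coe, Set.mem_singleton_iff, eq_iff_iff]
    refine forall₂_congr fun e he => ?_
    have := hF e he
    simp [this]
  rw [this, Measure.infinitePi_pi _ (fun i _ => measurableSet_singleton _)]
  have key : ∀ e ∈ F, ((unitInterval.toNNReal p : NNReal) • Measure.dirac (e ∈ (Sym2.diagSetᶜ : Set (Sym2 ℕ))) +
      (unitInterval.toNNReal (unitInterval.symm p)) • Measure.dirac False) {e ∈ E} =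
        ENNReal.ofReal (if e ∈ E then (p : ℝ) else 1 - p) := by
    intro e he
    have := hF e he
    by_cases h : e ∈ E
    · simp [h, this, ENNReal.ofReal]
      exact NNReal.eq (by simp [h0])
    · have h2 : unitInterval.toNNReal (unitInterval.symm p) = (1 - (p : ℝ)).toNNReal :=
        NNReal.eq (by simp [p.2.2])
      simp [h, this, h2, ENNReal.ofReal]
  rw [Finset.prod_congr rfl key, ← ENNReal.ofReal_prod_of_nonneg]
  · rw [Finset.prod_ite, Finset.prod_const, Finset.prod_const, Finset.filter_mem_eq_inter,
      Finset.inter_eq_right.2 hE, Finset.filter_notMem_eq_sdiff]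
  · intro e _
    split_ifs <;> assumption

theorem measurableSet_mem_edgeSet (e : Sym2 ℕ) :
    MeasurableSet {G : SimpleGraph ℕ | e ∈ G.edgeSet} :=
  measurableSet_setOfPred.2 (by fun_prop)

/-- Conditioned on the answers received so far, a fresh query is still positive with probability p.
Working inside a cylinder turns this into a recursion on the tree, so that later arguments need no
measure theory. -/
theorem Strategy.binomialRandom_revealed (p : I) (P : Set (Sym2 ℕ) → Prop) (T : Strategy)
    {F E : Finset (Sym2 ℕ)} (hE : E ⊆ F) (hF : ∀ e ∈ F, ¬ e.IsDiag) (hT : T.Fresh F) :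
    SimpleGraph.binomialRandom ℕ p (cylinder F E ∩ {G | P (E ∪ T.revealed G)}) =
      ENNReal.ofReal ((p : ℝ) ^ E.card * (1 - p) ^ (F \ E).card *
        T.value p (fun _ E' => P E') F E) := by
  classical
  have h0 : (0 : ℝ) ≤ p := p.2.1
  have h1 : (0 : ℝ) ≤ 1 - p := sub_nonneg.2 p.2.2
  induction T generalizing F E with
  | done =>
    unfold Strategy.revealed Strategy.value
    by_cases h : P E
    · simp [h, binomialRandom_cylinder p hE hF]
    · simp [h]
  | query u v no yes hno hyes =>
    obtain ⟨huv, hf, hfn, hfy⟩ := hT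
    have hF' : ∀ e ∈ insert s(u, v) F, ¬ e.IsDiag := by
      intro e he
      rcases Finset.mem_insert.1 he with rfl | he
      · simpa using huv
      · exact hF e he
    have hfE : s(u, v) ∉ E := fun h => hf (hE h)
    -- Splitting by the answer to the first query gives two smaller cylinders, one for each subtree.
    rw [← measure_inter_add_sdiff _ (measurableSet_mem_edgeSet s(u, v))]
    have e1 : cylinder F E ∩ {G | P (E ∪ (Strategy.query u v no yes).revealed G)} ∩
        {G | s(u, v) ∈ G.edgeSet} = cylinder (insert s(u, v) F) (insert s(u, v) E) ∩
          {G | P (↑(insert s(u, v) E) ∪ yes.revealed G)} := by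
      ext G
      simp only [cylinder, Set.mem_inter_iff, Set.mem_ofPred_eq, Finset.mem_insert,
        forall_eq_or_imp, true_or, iff_true]
      have h3 : (∀ a ∈ F, (a ∈ G.edgeSet ↔ a = s(u, v) ∨ a ∈ E)) ↔
          ∀ a ∈ F, (a ∈ G.edgeSet ↔ a ∈ E) := by
        refine forall₂_congr fun a ha => ?_
        have : a ≠ s(u, v) := fun h => hf (h ▸ ha)
        simp [this]
      rw [h3]
      by_cases hG : s(u, v) ∈ G.edgeSet
      · have : G.Adj u v := hG
        simp [Strategy.revealed, this, Set.insert_union, Set.union_insert]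
      · simp [hG]
    have e2 : (cylinder F E ∩ {G | P (E ∪ (Strategy.query u v no yes).revealed G)}) \
        {G | s(u, v) ∈ G.edgeSet} = cylinder (insert s(u, v) F) E ∩
          {G | P (E ∪ no.revealed G)} := by
      ext G
      simp only [cylinder, Set.mem_inter_iff, Set.mem_ofPred_eq, Finset.mem_insert,
        forall_eq_or_imp, Set.mem_sdiff, hfE, iff_false]
      by_cases hG : s(u, v) ∈ G.edgeSet
      · simp [hG]
      · have : ¬ G.Adj u v := hG
        simp [Strategy.revealed, this]
    rw [e1, e2, hyes (Finset.insert_subset_insert _ hE) hF' hfy,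
      hno (hE.trans (Finset.subset_insert _ _)) hF' hfn, ← ENNReal.ofReal_add]
    · congr 1
      have c1 : insert s(u, v) F \ insert s(u, v) E = F \ E := by
        ext a; by_cases ha : a = s(u, v) <;> simp [ha, hf]
      have c2 : insert s(u, v) F \ E = insert s(u, v) (F \ E) :=
        Finset.insert_sdiff_of_notMem _ hfE
      rw [c1, c2, Finset.card_insert_of_notMem hfE, Finset.card_insert_of_notMem (by simp [hf]),
        Strategy.value]
      ring
    · have := yes.value_nonneg h0 (sub_nonneg.1 h1) (fun _ E' => P E') (insert s(u, v) F)
        (insert s(u, v) E)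
      positivity
    · have := no.value_nonneg h0 (sub_nonneg.1 h1) (fun _ E' => P E') (insert s(u, v) F) E
      positivity

theorem Strategy.binomialRandom_finds {V : Type*} (H : SimpleGraph V) (p : I) (T : Strategy)
    (hT : T.Fresh ∅) :
    SimpleGraph.binomialRandom ℕ p {G | T.Finds H G} = ENNReal.ofReal (T.value p
      (fun _ E => H.IsContained (SimpleGraph.fromEdgeSet (E : Set (Sym2 ℕ)))) ∅ ∅) := by
  have := T.binomialRandom_revealed p
    (fun E => H.IsContained (SimpleGraph.fromEdgeSet E)) (Finset.Subset.refl ∅) (by simp) hT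
  simpa [cylinder, Strategy.Finds] using this

/-! ### Achievable goals -/

/-- From queried pairs `F` and revealed edges `E`, some strategy with at most `n` further queries
reaches a state satisfying `g` with probability at least `q`. -/
def Achieves (p : ℝ) (F E : Finset (Sym2 ℕ)) (n : ℕ) (q : ℝ)
    (g : Finset (Sym2 ℕ) → Finset (Sym2 ℕ) → Prop) : Prop :=
  ∃ T : Strategy, T.cost ≤ n ∧ T.Fresh F ∧ q ≤ T.value p g F E

variable {p : ℝ} {F E : Finset (Sym2 ℕ)} {g g' : Finset (Sym2 ℕ) → Finset (Sym2 ℕ) → Prop}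

theorem Achieves.of_goal (h : g F E) : Achieves p F E 0 1 g :=
  ⟨.done, le_rfl, trivial, by simp [Strategy.value, h]⟩

theorem Achieves.mono {n n' : ℕ} {q q' : ℝ} (h : Achieves p F E n q g) (hn : n ≤ n')
    (hq : q' ≤ q) : Achieves p F E n' q' g := by
  obtain ⟨T, h1, h2, h3⟩ := h
  exact ⟨T, h1.trans hn, h2, hq.trans h3⟩

/-- Grafting a second strategy onto each successful leaf of the first: the costs add and the success
probabilities multiply, because `g` sees the whole state at the leaf, including the pairs already
queried. -/
theorem Achieves.bind (hp0 : 0 ≤ p) (hp1 : p ≤ 1) {n n' : ℕ} {q q' : ℝ} (hq' : 0 ≤ q')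
    (h : Achieves p F E n q g) (h' : ∀ F' E', g F' E' → Achieves p F' E' n' q' g') :
    Achieves p F E (n + n') (q' * q) g' := by
  obtain ⟨T, hc, hf, hq⟩ := h
  suffices ∃ T' : Strategy, T'.cost ≤ T.cost + n' ∧ T'.Fresh F ∧
      q' * T.value p g F E ≤ T'.value p g' F E by
    obtain ⟨T', h1, h2, h3⟩ := this
    exact ⟨T', by omega, h2, (mul_le_mul_of_nonneg_left hq hq').trans h3⟩
  clear hc hq
  induction T generalizing F E with
  | done =>
    by_cases hg : g F E
    · obtain ⟨T', h1, h2, h3⟩ := h' F E hg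
      exact ⟨T', by simpa [Strategy.cost] using h1, h2, by simpa [Strategy.value, hg] using h3⟩
    · exact ⟨.done, by simp [Strategy.cost], trivial, by
        simpa [Strategy.value, hg] using Strategy.value_nonneg hp0 hp1 g' .done F E⟩
  | query u v no yes hno hyes =>
    obtain ⟨huv, hf, hfn, hfy⟩ := hf
    obtain ⟨N, n1, n2, n3⟩ := hno (E := E) hfn
    obtain ⟨Y, y1, y2, y3⟩ := hyes (E := insert s(u, v) E) hfy
    refine ⟨.query u v N Y, ?_, ⟨huv, hf, n2, y2⟩, ?_⟩
    · simp only [Strategy.cost]; omega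
    · have h1 : 0 ≤ 1 - p := by linarith
      have := mul_le_mul_of_nonneg_left y3 hp0
      have := mul_le_mul_of_nonneg_left n3 h1
      simp only [Strategy.value]
      linarith

-- A nonadaptive round of fresh queries reveals a Bernoulli subset, so its success probability is a
-- finite sum accessible to independence arguments.
open Classical in
theorem Achieves.batch (Q : Finset (Sym2 ℕ)) (hd : ∀ e ∈ Q, ¬ e.IsDiag) (hQ : Disjoint Q F) :
    Achieves p F E Q.card
      (bernoulliSum p Q fun S => if g (F ∪ Q) (E ∪ S) then 1 else 0) g := by
  suffices ∃ T : Strategy, T.cost ≤ Q.card ∧ T.Fresh F ∧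
      (bernoulliSum p Q fun S => if g (F ∪ Q) (E ∪ S) then 1 else 0) = T.value p g F E by
    obtain ⟨T, h1, h2, h3⟩ := this
    exact ⟨T, h1, h2, h3.le⟩
  induction Q using Finset.induction_on generalizing F E with
  | empty => exact ⟨.done, by simp [Strategy.cost], trivial, by
      simp [bernoulliSum_empty, Strategy.value]⟩
  | insert e Q he ih =>
    rw [Finset.disjoint_insert_left] at hQ
    have hd' : ∀ e ∈ Q, ¬ e.IsDiag := fun e h => hd e (Finset.mem_insert_of_mem h)
    have hQF : Disjoint Q (insert e F) := by
      rw [Finset.disjoint_insert_right]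
      exact ⟨he, hQ.2⟩
    obtain ⟨Y, y1, y2, y3⟩ := ih hd' hQF (E := insert e E)
    obtain ⟨N, n1, n2, n3⟩ := ih hd' hQF (E := E)
    have hde := hd e (Finset.mem_insert_self e Q)
    induction e with
    | _ u v =>
    refine ⟨.query u v N Y, ?_, ⟨by simpa using hde, hQ.1, n2, y2⟩, ?_⟩
    · rw [Finset.card_insert_of_notMem he]
      simp only [Strategy.cost]; omega
    · rw [bernoulliSum_insert he, Strategy.value, ← y3, ← n3]
      simp only [Finset.insert_union, Finset.union_insert]


/-! ### Events determined by disjoint blocks -/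

section BernoulliEvents

variable {α ι κ : Type*} [DecidableEq α] {p : ℝ}

open Classical in
theorem pow_card_le_bernoulliSum_forall (A : Finset ι)
    (Q : ι → Finset α) (hQ : (A : Set ι).PairwiseDisjoint Q) (P : ι → Finset α → Prop) {c : ℝ}
    (hc : 0 ≤ c) (h : ∀ a ∈ A, c ≤ bernoulliSum p (Q a) fun S => if P a S then 1 else 0) :
    c ^ A.card ≤
      bernoulliSum p (A.biUnion Q) fun S => if ∀ a ∈ A, P a (S ∩ Q a) then 1 else 0 := by
  have := bernoulliSum_biUnion_prod (p := p) A Q hQ fun a S => if P a S then 1 else 0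
  simp only [Finset.prod_ite_zero, Finset.prod_const_one] at this
  rw [this, ← Finset.prod_const]
  exact Finset.prod_le_prod (fun _ _ => hc) h

open Classical in
/-- Among disjoint blocks of at most `t` elements, many are contained in the random set. -/
theorem le_bernoulliSum_card_filter_subset (hp0 : 0 ≤ p) (hp1 : p ≤ 1) (A : Finset ι)
    (Q : ι → Finset α) (hQ : (A : Set ι).PairwiseDisjoint Q) (t L : ℕ)
    (ht : ∀ a ∈ A, (Q a).card ≤ t) :
    1 - 2 ^ L * (1 - p ^ t / 2) ^ A.card ≤
      bernoulliSum p (A.biUnion Q) fun S => if L ≤ {a ∈ A | Q a ⊆ S}.card then 1 else 0 := by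
  -- Exponential Markov inequality: if X counts the blocks contained in the random set, then 2^{-X}
  -- is a product of independent factors of mean 1 - p^|Q a|/2, and 2^{L-X} ≥ 1 whenever X < L.
  have hprod := bernoulliSum_biUnion_prod (p := p) A Q hQ fun a S =>
    1 - 1 / 2 * if Q a ⊆ S then 1 else 0
  have hle : ∏ a ∈ A, (bernoulliSum p (Q a) fun S => 1 - 1 / 2 * if Q a ⊆ S then 1 else 0) ≤
      (1 - p ^ t / 2) ^ A.card := by
    rw [← Finset.prod_const]
    refine Finset.prod_le_prod (fun a ha => ?_) fun a ha => ?_ <;>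
      rw [bernoulliSum_one_sub, bernoulliSum_const_mul, bernoulliSum_subset]
    · have := pow_le_one₀ hp0 hp1 (n := (Q a).card)
      linarith
    · have := pow_le_pow_of_le_one hp0 hp1 (ht a ha)
      linarith
  calc 1 - 2 ^ L * (1 - p ^ t / 2) ^ A.card
      ≤ 1 - 2 ^ L * bernoulliSum p (A.biUnion Q) fun S =>
          ∏ a ∈ A, (1 - 1 / 2 * if Q a ⊆ S ∩ Q a then 1 else 0) := by
        rw [hprod]
        gcongr
    _ ≤ _ := by
        rw [← bernoulliSum_const_mul, ← bernoulliSum_one_sub]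
        refine bernoulliSum_mono hp0 hp1 fun S _ => ?_
        have : ∏ a ∈ A, (1 - 1 / 2 * if Q a ⊆ S ∩ Q a then (1 : ℝ) else 0) =
            (1 / 2) ^ {a ∈ A | Q a ⊆ S}.card := by
          rw [← Finset.prod_const, Finset.prod_filter]
          refine Finset.prod_congr rfl fun a _ => ?_
          have : Q a ⊆ S ∩ Q a ↔ Q a ⊆ S := by simp [Finset.subset_inter_iff]
          simp only [this]
          split_ifs <;> norm_num
        rw [this]
        split_ifs with h
        · have : (0 : ℝ) < 2 ^ L * (1 / 2) ^ {a ∈ A | Q a ⊆ S}.card := by positivity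
          linarith
        · have : (1 : ℝ) ≤ 2 ^ L * (1 / 2) ^ {a ∈ A | Q a ⊆ S}.card := by
            rw [one_div, inv_pow, ← div_eq_mul_inv, one_le_div (by positivity)]
            exact pow_le_pow_right₀ (by norm_num) (by omega)
          linarith

open Classical in
/-- Among disjoint families of disjoint blocks of size `m`, some family has all its blocks met by
the random set. -/
theorem le_bernoulliSum_exists_forall_nonempty (hp0 : 0 ≤ p) (hp1 : p ≤ 1) (A : Finset ι)
    (B : Finset κ) (Q : ι → κ → Finset α)
    (hA : (A : Set ι).PairwiseDisjoint fun a => B.biUnion (Q a))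
    (hB : ∀ a ∈ A, (B : Set κ).PairwiseDisjoint (Q a)) (m : ℕ)
    (hm : ∀ a ∈ A, ∀ b ∈ B, (Q a b).card = m) :
    1 - (1 - (1 - (1 - p) ^ m) ^ B.card) ^ A.card ≤
      bernoulliSum p (A.biUnion fun a => B.biUnion (Q a)) fun S =>
        if ∃ a ∈ A, ∀ b ∈ B, (S ∩ Q a b).Nonempty then 1 else 0 := by
  have hin : ∀ a ∈ A, bernoulliSum p (B.biUnion (Q a)) (fun S =>
      if ∀ b ∈ B, (S ∩ Q a b).Nonempty then 1 else 0) = (1 - (1 - p) ^ m) ^ B.card := by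
    intro a ha
    have := bernoulliSum_biUnion_prod (p := p) B (Q a) (hB a ha) fun b S =>
      if S.Nonempty then 1 else 0
    simp only [Finset.prod_ite_zero, Finset.prod_const_one] at this
    rw [this, ← Finset.prod_const]
    refine Finset.prod_congr rfl fun b hb => ?_
    rw [← hm a ha b hb, ← bernoulliSum_eq_empty, ← bernoulliSum_one_sub]
    refine bernoulliSum_congr fun S _ => ?_
    by_cases h : S = ∅ <;> simp [h, Finset.nonempty_iff_ne_empty]
  have hprod := bernoulliSum_biUnion_prod (p := p) A (fun a => B.biUnion (Q a)) hA fun a S =>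
    1 - if ∀ b ∈ B, (S ∩ Q a b).Nonempty then 1 else 0
  have hpow : ∏ a ∈ A, (bernoulliSum p (B.biUnion (Q a)) fun S =>
      1 - if ∀ b ∈ B, (S ∩ Q a b).Nonempty then 1 else 0) =
        (1 - (1 - (1 - p) ^ m) ^ B.card) ^ A.card := by
    rw [← Finset.prod_const]
    exact Finset.prod_congr rfl fun a ha => by rw [bernoulliSum_one_sub, hin a ha]
  rw [← hpow, ← hprod, ← bernoulliSum_one_sub]
  refine bernoulliSum_mono hp0 hp1 fun S _ => ?_
  split_ifs with h
  · have : 0 ≤ ∏ a ∈ A, ((1 : ℝ) -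
        if ∀ b ∈ B, (S ∩ (B.biUnion (Q a)) ∩ Q a b).Nonempty then 1 else 0) :=
      Finset.prod_nonneg fun a _ => by split_ifs <;> norm_num
    linarith
  · push Not at h
    rw [Finset.prod_eq_one, sub_self]
    intro a ha
    obtain ⟨b, hb, hS⟩ := h a ha
    rw [if_neg, sub_zero]
    intro hall
    refine (hall b hb).ne_empty ?_
    rw [Finset.inter_assoc, Finset.inter_eq_right.2 (Finset.subset_biUnion_of_mem (Q a) hb)]
    simpa using hS

end BernoulliEvents

theorem exists_disjoint_subsets_card_eq {α : Type*} (A : Finset α) (n m : ℕ)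
    (h : n * m ≤ A.card) :
    ∃ B : ℕ → Finset α, (∀ i, B i ⊆ A) ∧ (∀ i < n, (B i).card = m) ∧
      ∀ i < n, ∀ j < n, i ≠ j → Disjoint (B i) (B j) := by
  classical
  induction n generalizing A with
  | zero => exact ⟨fun _ => ∅, by simp, by simp, by simp⟩
  | succ n ih =>
    rw [Nat.succ_mul] at h
    obtain ⟨C, hCA, hC⟩ := Finset.exists_subset_card_eq (show m ≤ A.card by omega)
    obtain ⟨B, hB, hBm, hd⟩ := ih (A \ C) (by rw [Finset.card_sdiff_of_subset hCA]; omega)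
    refine ⟨Function.update B n C, fun i => ?_, fun i hi => ?_, fun i hi j hj hij => ?_⟩
    · by_cases hin : i = n
      · simpa [hin] using hCA
      · simpa [hin] using (hB i).trans Finset.sdiff_subset
    · by_cases hin : i = n
      · simpa [hin] using hC
      · simpa [hin] using hBm i (by omega)
    · have hdis : ∀ k, Disjoint C (B k) := fun k =>
        Finset.disjoint_of_subset_right (hB k) Finset.disjoint_sdiff
      by_cases hin : i = n
      · subst hin
        simpa [hij.symm] using hdis j
      · by_cases hjn : j = n
        · subst hjn
          simpa [hij] using (hdis i).symm
        · simpa [hin, hjn] using hd i (by omega) j (by omega) hij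


/-! ### Partial embeddings and the two query rounds -/

section Embedding

variable {V : Type*} {D : Digraph V} {β : ℕ → V}

/-- Every queried pair joins a label `a` to a label `b` whose blocks are joined by an arc of `D`
starting at a vertex with all outneighbours in `P`. -/
def QueriedWithin (D : Digraph V) (β : ℕ → V) (P : Finset V) (F : Finset (Sym2 ℕ)) : Prop :=
  ∀ e ∈ F, ∃ a b, e = s(a, b) ∧ D.Adj (β a) (β b) ∧ ∀ y, D.Adj (β a) y → y ∈ P

/-- The vertices of `P` have been embedded by `x` along revealed edges, each in its own block, and
every other vertex `w` with all outneighbours in `P` has a set `U w` of at least `c w` possible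
images. -/
structure IsPartialEmbedding (D : Digraph V) (β : ℕ → V) (c : V → ℕ) (P : Finset V) (x : V → ℕ)
    (U : V → Finset ℕ) (E : Finset (Sym2 ℕ)) : Prop where
  block : ∀ v ∈ P, β (x v) = v
  closed : ∀ v ∈ P, ∀ y, D.Adj v y → y ∈ P
  edge : ∀ v ∈ P, ∀ y, D.Adj v y → s(x v, x y) ∈ E
  card_options : ∀ w ∉ P, (∀ y, D.Adj w y → y ∈ P) → c w ≤ (U w).card
  block_options : ∀ w ∉ P, (∀ y, D.Adj w y → y ∈ P) → ∀ u ∈ U w, β u = w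
  edge_options : ∀ w ∉ P, (∀ y, D.Adj w y → y ∈ P) → ∀ u ∈ U w, ∀ y, D.Adj w y → s(u, x y) ∈ E

/-- The blocks of its ends orient a queried pair, so pairs can be compared by tail and by head; all
freshness and disjointness claims below rest on this. -/
theorem eq_and_eq_of_mk_eq_mk (hD : ∀ u v, D.Adj u v → ¬ D.Adj v u) {a b a' b' : ℕ}
    (h : D.Adj (β a) (β b)) (h' : D.Adj (β a') (β b')) (he : s(a, b) = s(a', b')) :
    a = a' ∧ b = b' := by
  rcases Sym2.eq_iff.1 he with h1 | ⟨rfl, rfl⟩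
  · exact h1
  · exact absurd h' (hD _ _ h)

theorem not_isDiag_of_adj (hD : ∀ u v, D.Adj u v → ¬ D.Adj v u) {a b : ℕ}
    (h : D.Adj (β a) (β b)) : ¬ s(a, b).IsDiag := by
  intro hab
  rw [Sym2.mk_isDiag_iff] at hab
  subst hab
  exact hD _ _ h h

variable [Fintype V] {p : ℝ} {F E : Finset (Sym2 ℕ)}

open Classical in
/-- Finding many common neighbours in the block of every `w ∈ W` for the embedded outneighbours of
`w` other than `z`. -/
theorem achieves_common_neighbors (hp0 : 0 ≤ p) (hp1 : p ≤ 1)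
    (hD : ∀ u v, D.Adj u v → ¬ D.Adj v u) {P : Finset V} {x : V → ℕ} (hx : ∀ v ∈ P, β (x v) = v)
    (hF : QueriedWithin D β P F) {z : V} (hz : z ∉ P) {d : ℕ} (hd : OutdegreeLE D d)
    {W : Finset V} (hW : ∀ w ∈ W, D.Adj w z ∧ ∀ y, D.Adj w y → y ∈ insert z P)
    {C : V → Finset ℕ} (hC : ∀ w, ∀ a ∈ C w, β a = w) {M L : ℕ} (hM : ∀ w, (C w).card = M)
    {δ : ℝ} (hδ0 : 0 ≤ δ) (hδ1 : δ ≤ 1) (hprob : 2 ^ L * (1 - p ^ (d - 1) / 2) ^ M ≤ δ) :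
    Achieves p F E (Fintype.card V * (M * d)) ((1 - δ) ^ Fintype.card V) fun F' E' =>
      E ⊆ E' ∧
      (∀ e ∈ F', ∃ a b, e = s(a, b) ∧ D.Adj (β a) (β b) ∧
        (∀ y, D.Adj (β a) y → y ∈ insert z P) ∧ β b ≠ z) ∧
      ∃ Y : V → Finset ℕ, ∀ w ∈ W, L ≤ (Y w).card ∧ ∀ a ∈ Y w, β a = w ∧
        ∀ y, D.Adj w y → y ≠ z → s(a, x y) ∈ E' := by
  set N : V → Finset V := fun w => {y | D.Adj w y ∧ y ≠ z} with hN
  set Q : V → ℕ → Finset (Sym2 ℕ) := fun w a => (N w).image fun y => s(a, x y) with hQ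
  set R : V → Finset (Sym2 ℕ) := fun w => (C w).biUnion (Q w) with hR
  have hNP : ∀ w ∈ W, ∀ y ∈ N w, y ∈ P := by
    intro w hw y hy
    simp only [hN, Finset.mem_filter, Finset.mem_univ, true_and] at hy
    exact Finset.mem_of_mem_insert_of_ne ((hW w hw).2 y hy.1) hy.2
  have hNadj : ∀ w ∈ W, ∀ a ∈ C w, ∀ y ∈ N w, D.Adj (β a) (β (x y)) := by
    intro w hw a ha y hy
    rw [hC w a ha, hx y (hNP w hw y hy)]
    simp only [hN, Finset.mem_filter] at hy
    exact hy.2.1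
  have hNcard : ∀ w ∈ W, (N w).card ≤ d - 1 := by
    intro w hw
    have h1 : insert z (N w) ⊆ ({y | D.Adj w y} : Finset V) := by
      intro y hy
      rcases Finset.mem_insert.1 hy with rfl | hy
      · simpa using (hW w hw).1
      · simp only [hN, Finset.mem_filter] at hy
        simpa using hy.2.1
    have h2 := Finset.card_le_card h1
    rw [Finset.card_insert_of_notMem (by simp [hN])] at h2
    have h3 : ({y | D.Adj w y} : Finset V).card ≤ d := by
      have := hd w
      rw [Set.ncard_eq_toFinset_card'] at this
      simpa using this
    omega
  have hQcard : ∀ w ∈ W, ∀ a, (Q w a).card ≤ d - 1 := fun w hw a =>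
    Finset.card_image_le.trans (hNcard w hw)
  have hmemQ : ∀ w ∈ W, ∀ a ∈ C w, ∀ e ∈ Q w a, ∃ b, e = s(a, b) ∧ D.Adj (β a) (β b) ∧
      β b ≠ z := by
    intro w hw a ha e he
    obtain ⟨y, hy, rfl⟩ := Finset.mem_image.1 he
    refine ⟨x y, rfl, hNadj w hw a ha y hy, ?_⟩
    rw [hx y (hNP w hw y hy)]
    rintro rfl
    exact hz (hNP w hw _ hy)
  have hmemR : ∀ w ∈ W, ∀ e ∈ R w, ∃ a b, e = s(a, b) ∧ β a = w ∧ D.Adj (β a) (β b) ∧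
      β b ≠ z := by
    intro w hw e he
    obtain ⟨a, ha, hea⟩ := Finset.mem_biUnion.1 he
    obtain ⟨b, rfl, h1, h2⟩ := hmemQ w hw a ha e hea
    exact ⟨a, b, rfl, hC w a ha, h1, h2⟩
  have hQdisj : ∀ w ∈ W, (C w : Set ℕ).PairwiseDisjoint (Q w) := by
    intro w hw a ha a' ha' hne
    refine Finset.disjoint_left.2 fun e he he' => ?_
    obtain ⟨b, rfl, h1, -⟩ := hmemQ w hw a ha e he
    obtain ⟨b', h0, h1', -⟩ := hmemQ w hw a' ha' _ he'
    exact hne (eq_and_eq_of_mk_eq_mk hD h1 h1' h0).1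
  have hRdisj : (W : Set V).PairwiseDisjoint R := by
    intro w hw w' hw' hne
    refine Finset.disjoint_left.2 fun e he he' => ?_
    obtain ⟨a, b, rfl, h0, h1, -⟩ := hmemR w hw e he
    obtain ⟨a', b', he, h0', h1', -⟩ := hmemR w' hw' _ he'
    exact hne (by rw [← h0, ← h0', (eq_and_eq_of_mk_eq_mk hD h1 h1' he).1])
  have hmem : ∀ e ∈ W.biUnion R, ∃ a b, e = s(a, b) ∧ β a ∈ W ∧ D.Adj (β a) (β b) ∧
      β b ≠ z := by
    intro e he
    obtain ⟨w, hw, hew⟩ := Finset.mem_biUnion.1 he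
    obtain ⟨a, b, h1, rfl, h2⟩ := hmemR w hw e hew
    exact ⟨a, b, h1, hw, h2⟩
  -- The tail of a new pair lies in the block of some `w ∈ W`, whose outneighbour `z` is not yet
  -- placed, whereas tails of old pairs have all outneighbours in `P`.
  have hfresh : Disjoint (W.biUnion R) F := by
    refine Finset.disjoint_left.2 fun e he he' => ?_
    obtain ⟨a, b, rfl, haW, hab, -⟩ := hmem e he
    obtain ⟨a', b', h0, hab', hP⟩ := hF _ he'
    obtain ⟨rfl, rfl⟩ := eq_and_eq_of_mk_eq_mk hD hab hab' h0
    exact hz (hP z (hW _ haW).1)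
  have hloop : ∀ e ∈ W.biUnion R, ¬ e.IsDiag := by
    intro e he
    obtain ⟨a, b, rfl, -, hab, -⟩ := hmem e he
    exact not_isDiag_of_adj hD hab
  refine (Achieves.batch (W.biUnion R) hloop hfresh).mono ?_ ?_
  · calc (W.biUnion R).card ≤ W.card * (M * d) := by
          refine Finset.card_biUnion_le_card_mul _ _ _ fun w hw => ?_
          rw [← hM w]
          exact Finset.card_biUnion_le_card_mul _ _ _ fun a _ =>
            (hQcard w hw a).trans (Nat.sub_le d 1)
      _ ≤ _ := Nat.mul_le_mul_right _ (Finset.card_le_univ W)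
  · calc (1 - δ) ^ Fintype.card V ≤ (1 - δ) ^ W.card :=
          pow_le_pow_of_le_one (by linarith) (by linarith) (Finset.card_le_univ W)
      _ ≤ _ := pow_card_le_bernoulliSum_forall W R hRdisj
          (fun w S => L ≤ {a ∈ C w | Q w a ⊆ S}.card) (by linarith) fun w hw => by
            refine le_trans ?_ ((le_bernoulliSum_card_filter_subset hp0 hp1 (C w) (Q w)
              (hQdisj w hw) (d - 1) L fun a _ => hQcard w hw a).trans_eq (by congr!))
            rw [hM]
            linarith
      _ ≤ _ := by
          refine bernoulliSum_mono hp0 hp1 fun S hS => ?_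
          by_cases h : ∀ w ∈ W, L ≤ {a ∈ C w | Q w a ⊆ S ∩ R w}.card
          · rw [if_pos h, if_pos]
            refine ⟨Finset.subset_union_left, fun e he => ?_,
              fun w => {a ∈ C w | Q w a ⊆ S ∩ R w}, fun w hw => ⟨h w hw, fun a ha => ?_⟩⟩
            · rcases Finset.mem_union.1 he with he | he
              · obtain ⟨a, b, h0, h1, h2⟩ := hF e he
                refine ⟨a, b, h0, h1, fun y hy => Finset.mem_insert_of_mem (h2 y hy), ?_⟩
                rintro hb
                exact hz (hb ▸ h2 _ h1)
              · obtain ⟨a, b, h0, h1, h2, h3⟩ := hmem e he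
                exact ⟨a, b, h0, h2, (hW _ h1).2, h3⟩
            · rw [Finset.mem_filter] at ha
              refine ⟨hC w a ha.1, fun y hy hyz => Finset.mem_union_right _ ?_⟩
              refine Finset.mem_of_mem_inter_left (ha.2 ?_)
              exact Finset.mem_image_of_mem _ (by simp [hN, hy, hyz])
          · rw [if_neg h]
            split_ifs <;> norm_num

open Classical in
/-- Among the possible images of `z`, finding one joined to many vertices of each `Y w`. -/
theorem achieves_good_image (hp0 : 0 ≤ p) (hp1 : p ≤ 1)
    (hD : ∀ u v, D.Adj u v → ¬ D.Adj v u) {P : Finset V} {z : V}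
    (hF : ∀ e ∈ F, ∃ a b, e = s(a, b) ∧ D.Adj (β a) (β b) ∧
      (∀ y, D.Adj (β a) y → y ∈ insert z P) ∧ β b ≠ z)
    {W : Finset V} (hW : ∀ w ∈ W, D.Adj w z ∧ ∀ y, D.Adj w y → y ∈ insert z P)
    {A : Finset ℕ} (hA : ∀ u ∈ A, β u = z) {Y : V → Finset ℕ} {n m : ℕ}
    (hYcard : ∀ w ∈ W, n * m ≤ (Y w).card) (hY : ∀ w ∈ W, ∀ a ∈ Y w, β a = w)
    {δ : ℝ} (hprob : (1 - (1 - (1 - p) ^ m) ^ (W.card * n)) ^ A.card ≤ δ) :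
    Achieves p F E (A.card * (W.card * (n * m))) (1 - δ) fun F' E' =>
      E ⊆ E' ∧ QueriedWithin D β (insert z P) F' ∧
      ∃ u ∈ A, ∀ w ∈ W, n ≤ {a ∈ Y w | s(a, u) ∈ E'}.card := by
  have hex : ∀ w, ∃ B : ℕ → Finset ℕ, w ∈ W → (∀ i, B i ⊆ Y w) ∧ (∀ i < n, (B i).card = m) ∧
      ∀ i < n, ∀ j < n, i ≠ j → Disjoint (B i) (B j) := by
    intro w
    by_cases hw : w ∈ W
    · obtain ⟨B, hB⟩ := exists_disjoint_subsets_card_eq (Y w) n m (hYcard w hw)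
      exact ⟨B, fun _ => hB⟩
    · exact ⟨fun _ => ∅, fun h => absurd h hw⟩
  choose B hB using hex
  set J : Finset (V × ℕ) := W ×ˢ Finset.range n with hJ
  set Q : ℕ → V × ℕ → Finset (Sym2 ℕ) := fun u j => (B j.1 j.2).image fun a => s(a, u) with hQ
  have hmemJ : ∀ j ∈ J, j.1 ∈ W ∧ j.2 < n := fun j hj => by simpa [hJ] using hj
  have hmemQ : ∀ u ∈ A, ∀ j ∈ J, ∀ e ∈ Q u j, ∃ a ∈ B j.1 j.2, e = s(a, u) ∧ β a = j.1 ∧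
      D.Adj (β a) (β u) := by
    intro u hu j hj e he
    obtain ⟨a, ha, rfl⟩ := Finset.mem_image.1 he
    have hj' := hmemJ j hj
    have hβ := hY j.1 hj'.1 a ((hB j.1 hj'.1).1 j.2 ha)
    refine ⟨a, ha, rfl, hβ, ?_⟩
    rw [hβ, hA u hu]
    exact (hW _ hj'.1).1
  have hQcard : ∀ u ∈ A, ∀ j ∈ J, (Q u j).card = m := by
    intro u hu j hj
    have hj' := hmemJ j hj
    rw [hQ, Finset.card_image_of_injective, (hB j.1 hj'.1).2.1 j.2 hj'.2]
    exact fun a a' h => Sym2.congr_left.1 h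
  have hdisjJ : ∀ u ∈ A, (J : Set (V × ℕ)).PairwiseDisjoint (Q u) := by
    intro u hu j hj j' hj' hne
    refine Finset.disjoint_left.2 fun e he he' => ?_
    obtain ⟨a, ha, rfl, h1, h2⟩ := hmemQ u hu j hj e he
    obtain ⟨a', ha', h0, h1', h2'⟩ := hmemQ u hu j' hj' _ he'
    obtain ⟨rfl, -⟩ := eq_and_eq_of_mk_eq_mk hD h2 h2' h0
    have hw : j.1 = j'.1 := h1.symm.trans h1'
    have hi : j.2 ≠ j'.2 := fun h => hne (Prod.ext hw h)
    rw [← hw] at ha'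
    have hj1 := hmemJ j hj
    exact Finset.disjoint_left.1
      ((hB j.1 hj1.1).2.2 j.2 hj1.2 j'.2 (hmemJ j' hj').2 hi) ha ha'
  have hmem : ∀ u ∈ A, ∀ e ∈ J.biUnion (Q u), ∃ a, e = s(a, u) ∧ β a ∈ W ∧
      D.Adj (β a) (β u) := by
    intro u hu e he
    obtain ⟨j, hj, hej⟩ := Finset.mem_biUnion.1 he
    obtain ⟨a, -, h1, h2, h3⟩ := hmemQ u hu j hj e hej
    exact ⟨a, h1, h2 ▸ (hmemJ j hj).1, h3⟩
  have hdisjA : (A : Set ℕ).PairwiseDisjoint fun u => J.biUnion (Q u) := by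
    intro u hu u' hu' hne
    refine Finset.disjoint_left.2 fun e he he' => ?_
    obtain ⟨a, rfl, -, h1⟩ := hmem u hu e he
    obtain ⟨a', h0, -, h1'⟩ := hmem u' hu' _ he'
    exact hne (eq_and_eq_of_mk_eq_mk hD h1 h1' h0).2
  have hall : ∀ e ∈ A.biUnion fun u => J.biUnion (Q u), ∃ a u, e = s(a, u) ∧ β a ∈ W ∧
      D.Adj (β a) (β u) ∧ β u = z := by
    intro e he
    obtain ⟨u, hu, heu⟩ := Finset.mem_biUnion.1 he
    obtain ⟨a, h1, h2, h3⟩ := hmem u hu e heu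
    exact ⟨a, u, h1, h2, h3, hA u hu⟩
  refine (Achieves.batch (A.biUnion fun u => J.biUnion (Q u)) ?_ ?_).mono ?_ ?_
  · intro e he
    obtain ⟨a, u, rfl, -, h, -⟩ := hall e he
    exact not_isDiag_of_adj hD h
  -- The pairs queried here have their head in the block of `z`, which no earlier pair has.
  · refine Finset.disjoint_left.2 fun e he he' => ?_
    obtain ⟨a, u, rfl, -, h1, h2⟩ := hall e he
    obtain ⟨a', u', h0, h1', -, h2'⟩ := hF _ he'
    obtain ⟨rfl, rfl⟩ := eq_and_eq_of_mk_eq_mk hD h1 h1' h0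
    exact h2' h2
  · refine Finset.card_biUnion_le_card_mul _ _ _ fun u hu => ?_
    refine (Finset.card_biUnion_le_card_mul _ _ m fun j hj => (hQcard u hu j hj).le).trans ?_
    rw [hJ, Finset.card_product, Finset.card_range, mul_assoc]
  · have hmain := le_bernoulliSum_exists_forall_nonempty hp0 hp1 A J Q hdisjA hdisjJ m hQcard
    rw [hJ, Finset.card_product, Finset.card_range, ← hJ] at hmain
    refine (le_trans (by linarith) hmain).trans (bernoulliSum_mono hp0 hp1 fun S hS => ?_)
    by_cases h : ∃ u ∈ A, ∀ j ∈ J, (S ∩ Q u j).Nonempty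
    · rw [if_pos h, if_pos]
      obtain ⟨u, hu, hh⟩ := h
      refine ⟨Finset.subset_union_left, fun e he => ?_, u, hu, fun w hw => ?_⟩
      · rcases Finset.mem_union.1 he with he | he
        · obtain ⟨a, b, h0, h1, h2, -⟩ := hF e he
          exact ⟨a, b, h0, h1, h2⟩
        · obtain ⟨a, u, h0, h1, h2, -⟩ := hall e he
          exact ⟨a, u, h0, h2, (hW _ h1).2⟩
      · have hpick : ∀ i, ∃ a, i < n → a ∈ B w i ∧ s(a, u) ∈ S := by
          intro i
          by_cases hi : i < n
          · obtain ⟨e, he⟩ := hh (w, i) (by simp [hJ, hw, hi])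
            rw [Finset.mem_inter] at he
            obtain ⟨a, ha, rfl⟩ := Finset.mem_image.1 he.2
            exact ⟨a, fun _ => ⟨ha, he.1⟩⟩
          · exact ⟨0, fun h => absurd h hi⟩
        -- One neighbour of `u` from each of the `n` disjoint groups, hence `n` distinct neighbours.
        choose φ hφ using hpick
        have := Finset.card_le_card_of_injOn (s := Finset.range n)
          (t := {a ∈ Y w | s(a, u) ∈ E ∪ S}) φ (fun i hi => by
            have hi' := hφ i (by simpa using hi)
            have := (hB w hw).1 i hi'.1
            simp [this, hi'.2]) (fun i hi j hj hij => by
            by_contra hne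
            have hi' : i < n := by simpa using hi
            have hj' : j < n := by simpa using hj
            refine Finset.disjoint_left.1 ((hB w hw).2.2 i hi' j hj' hne) (hφ i hi').1 ?_
            rw [hij]
            exact (hφ j hj').1)
        simpa using this
    · rw [if_neg h]
      split_ifs <;> norm_num

end Embedding


/-! ### Placing one more vertex, and the whole strategy -/

section Extension

variable {V : Type*} [Fintype V] {D : Digraph V} {β : ℕ → V} {lev : V → ℕ} {p : ℝ}

-- The inductive step of the embedding: one round of `achieves_common_neighbors`, which can fail for
-- each newly ready vertex, then one of `achieves_good_image`. Together they account for the |V| + 1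
-- factors 1 - δ.
open Classical in
theorem achieves_extend (hp0 : 0 ≤ p) (hp1 : p ≤ 1) {d Δ : ℕ} (hd : OutdegreeLE D d)
    (hlev : ∀ v w, D.Adj v w → lev w < lev v) (hΔ : ∀ v, lev v ≤ Δ)
    (hβ : ∀ v, (β ⁻¹' {v}).Infinite) {k m : ℕ → ℕ} {M L K : ℕ} {δ : ℝ} (hδ0 : 0 ≤ δ)
    (hδ1 : δ ≤ 1) (hk : ∀ i j, i ≤ j → j ≤ Δ → k j ≤ k i) (hk1 : ∀ i ≤ Δ, 1 ≤ k i)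
    (hL : ∀ i < Δ, k (i + 1) * m (i + 1) ≤ L)
    (hprobM : 2 ^ L * (1 - p ^ (d - 1) / 2) ^ M ≤ δ)
    (hprobk : ∀ i < Δ,
      (1 - (1 - (1 - p) ^ m (i + 1)) ^ (Fintype.card V * k (i + 1))) ^ k i ≤ δ)
    (hK : ∀ i < Δ, k i * (Fintype.card V * (k (i + 1) * m (i + 1))) ≤ K)
    {P : Finset V} {x : V → ℕ} {U : V → Finset ℕ} {F E : Finset (Sym2 ℕ)}
    (hP : P.card < Fintype.card V)
    (hemb : IsPartialEmbedding D β (fun w => k (lev w)) P x U E) (hF : QueriedWithin D β P F) :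
    Achieves p F E (Fintype.card V * (M * d) + K) ((1 - δ) * (1 - δ) ^ Fintype.card V)
      fun F' E' => ∃ P' x' U', P'.card = P.card + 1 ∧
        IsPartialEmbedding D β (fun w => k (lev w)) P' x' U' E' ∧ QueriedWithin D β P' F' := by
  have hD : ∀ u v, D.Adj u v → ¬ D.Adj v u := fun u v h h' =>
    lt_asymm (hlev u v h) (hlev v u h')
  obtain ⟨z, hzP, hzmin⟩ : ∃ z ∉ P, ∀ y, D.Adj z y → y ∈ P := by
    have hne : (Pᶜ).Nonempty := by
      rw [← Finset.card_pos, Finset.card_compl]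
      omega
    -- Levels drop along arcs, so the outneighbours of an unplaced vertex of least level are placed.
    obtain ⟨z, hz, hmin⟩ := Finset.exists_min_image Pᶜ lev hne
    refine ⟨z, by simpa using hz, fun y hy => ?_⟩
    by_contra hyP
    exact absurd (hmin y (by simpa using hyP)) (not_le.2 (hlev z y hy))
  obtain ⟨C, hC⟩ : ∃ C : V → Finset ℕ, ∀ w, (∀ a ∈ C w, β a = w) ∧ (C w).card = M := by
    have : ∀ w, ∃ C : Finset ℕ, (∀ a ∈ C, β a = w) ∧ C.card = M := by
      intro w
      obtain ⟨C, h1, h2⟩ := (hβ w).exists_subset_card_eq M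
      exact ⟨C, fun a ha => h1 ha, h2⟩
    choose C hC using this
    exact ⟨C, hC⟩
  obtain ⟨A, hAU, hA⟩ := Finset.exists_subset_card_eq (hemb.card_options z hzP hzmin)
  have hAz : ∀ u ∈ A, β u = z := fun u hu => hemb.block_options z hzP hzmin u (hAU hu)
  set W : Finset V := {w | D.Adj w z ∧ ∀ y, D.Adj w y → y ∈ insert z P} with hWdef
  have hW : ∀ w ∈ W, D.Adj w z ∧ ∀ y, D.Adj w y → y ∈ insert z P := fun w hw => by
    simpa [hWdef] using hw
  have hWlev : W.Nonempty → lev z < Δ := fun ⟨w, hw⟩ =>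
    (hlev w z (hW w hw).1).trans_le (hΔ w)
  refine Achieves.bind (n' := K) hp0 hp1 (by linarith) (achieves_common_neighbors hp0 hp1 hD
    hemb.block hF hzP hd hW (fun w => (hC w).1) (fun w => (hC w).2) hδ0 hδ1 hprobM) ?_
  rintro F₁ E₁ ⟨hEE₁, hF₁, Y, hY⟩
  have hsecond := achieves_good_image (E := E₁) (δ := δ) hp0 hp1 hD hF₁ hW hAz
    (n := k (lev z + 1)) (m := m (lev z + 1)) (Y := Y)
    (fun w hw => (hL _ (hWlev ⟨w, hw⟩)).trans (hY w hw).1)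
    (fun w hw a ha => ((hY w hw).2 a ha).1) (by
      rw [hA]
      -- If no vertex becomes ready, any candidate will do; the bound then reads 0 ^ k ≤ δ with k ≥
      -- 1.
      rcases W.eq_empty_or_nonempty with h | h
      · have := hk1 (lev z) (hΔ z)
        rw [h]
        simpa [Nat.one_le_iff_ne_zero.1 this] using hδ0
      · refine le_trans ?_ (hprobk (lev z) (hWlev h))
        have h1 : 0 ≤ (1 - p) ^ m (lev z + 1) := pow_nonneg (by linarith) _
        have h2 : (1 - p) ^ m (lev z + 1) ≤ 1 := pow_le_one₀ (by linarith) (by linarith)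
        refine pow_le_pow_left₀ (sub_nonneg.2 (pow_le_one₀ (by linarith) (by linarith))) ?_ _
        refine sub_le_sub_left (pow_le_pow_of_le_one (by linarith) (by linarith) ?_) _
        exact Nat.mul_le_mul_right _ (Finset.card_le_univ W))
  obtain ⟨T, hT1, hT2, hT3⟩ := hsecond
  refine ⟨T, hT1.trans ?_, hT2, hT3.trans ?_⟩
  · rcases W.eq_empty_or_nonempty with h | h
    · simp [h]
    · refine le_trans ?_ (hK (lev z) (hWlev h))
      rw [hA]
      exact Nat.mul_le_mul_left _ (Nat.mul_le_mul_right _ (Finset.card_le_univ W))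
  · refine Strategy.value_mono hp0 hp1 (fun F₂ E₂ => ?_) T F₁ E₁
    rintro ⟨hE₁E₂, hF₂, u, huA, hu⟩
    have hEE₂ : E ⊆ E₂ := hEE₁.trans hE₁E₂
    set x' := Function.update x z u with hx'
    have hxP : ∀ y ∈ P, x' y = x y := fun y hy =>
      Function.update_of_ne (by rintro rfl; exact hzP hy) _ _
    have hxz : x' z = u := Function.update_self _ _ _
    -- A ready vertex with an arc to `z` has just become ready and takes the neighbours of `u` in `Y
    -- w`; any other was ready before and keeps its reservoir.
    refine ⟨insert z P, x', fun w => if D.Adj w z then {a ∈ Y w | s(a, u) ∈ E₂} else U w,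
      Finset.card_insert_of_notMem hzP, ?_, hF₂⟩
    have hold : ∀ w ∉ insert z P, (∀ y, D.Adj w y → y ∈ insert z P) → ¬ D.Adj w z →
        w ∉ P ∧ ∀ y, D.Adj w y → y ∈ P := fun w hw h hwz =>
      ⟨fun h' => hw (Finset.mem_insert_of_mem h'), fun y hy =>
        Finset.mem_of_mem_insert_of_ne (h y hy) fun h' => hwz (h' ▸ hy)⟩
    refine ⟨?_, ?_, ?_, ?_, ?_, ?_⟩
    · intro v hv
      rcases Finset.mem_insert.1 hv with rfl | hv
      · rw [hxz]; exact hAz u huA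
      · rw [hxP v hv]; exact hemb.block v hv
    · intro v hv y hy
      rcases Finset.mem_insert.1 hv with rfl | hv
      · exact Finset.mem_insert_of_mem (hzmin y hy)
      · exact Finset.mem_insert_of_mem (hemb.closed v hv y hy)
    · intro v hv y hy
      rcases Finset.mem_insert.1 hv with rfl | hv
      · rw [hxz, hxP y (hzmin y hy)]
        exact hEE₂ (hemb.edge_options v hzP hzmin u (hAU huA) y hy)
      · rw [hxP v hv, hxP y (hemb.closed v hv y hy)]
        exact hEE₂ (hemb.edge v hv y hy)
    · intro w hw h
      by_cases hwz : D.Adj w z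
      · simp only [if_pos hwz]
        exact (hk _ _ (hlev w z hwz) (hΔ w)).trans (hu w (by simp [hWdef, hwz]; simpa using h))
      · simp only [if_neg hwz]
        exact hemb.card_options w (hold w hw h hwz).1 (hold w hw h hwz).2
    · intro w hw h a ha
      by_cases hwz : D.Adj w z
      · simp only [if_pos hwz, Finset.mem_filter] at ha
        exact ((hY w (by simp [hWdef, hwz]; simpa using h)).2 a ha.1).1
      · simp only [if_neg hwz] at ha
        exact hemb.block_options w (hold w hw h hwz).1 (hold w hw h hwz).2 a ha
    · intro w hw h a ha y hy
      by_cases hwz : D.Adj w z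
      · simp only [if_pos hwz, Finset.mem_filter] at ha
        by_cases hyz : y = z
        · rw [hyz, hxz]; exact ha.2
        · rw [hxP y (Finset.mem_of_mem_insert_of_ne (h y hy) hyz)]
          exact hE₁E₂ (((hY w (by simp [hWdef, hwz]; simpa using h)).2 a ha.1).2 y hy hyz)
      · simp only [if_neg hwz] at ha
        have h' := hold w hw h hwz
        rw [hxP y (h'.2 y hy)]
        exact hEE₂ (hemb.edge_options w h'.1 h'.2 a ha y hy)

/-- The block map is a left inverse of the embedding, which gives injectivity. -/
theorem isContained_of_isPartialEmbedding {H : SimpleGraph V} {c : V → ℕ}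
    (hDH : ∀ u v, H.Adj u v ↔ D.Adj u v ∨ D.Adj v u) {P : Finset V}
    (hP : P.card = Fintype.card V) {x : V → ℕ} {U : V → Finset ℕ}
    {E : Finset (Sym2 ℕ)} (h : IsPartialEmbedding D β c P x U E) :
    H.IsContained (SimpleGraph.fromEdgeSet (E : Set (Sym2 ℕ))) := by
  have hPu : ∀ v, v ∈ P := fun v => by
    rw [Finset.card_eq_iff_eq_univ] at hP
    simp [hP]
  have hinj : Function.Injective x := Function.LeftInverse.injective fun v => h.block v (hPu v)
  refine ⟨⟨⟨x, fun {u v} huv => ?_⟩, hinj⟩⟩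
  rw [SimpleGraph.fromEdgeSet_adj]
  refine ⟨?_, fun h' => huv.ne (hinj h')⟩
  rcases (hDH u v).1 huv with h' | h'
  · exact h.edge u (hPu u) v h'
  · rw [Sym2.eq_swap]
    exact h.edge v (hPu v) u h'

theorem exists_infinite_fibers (V : Type*) [Countable V] [Nonempty V] :
    ∃ β : ℕ → V, ∀ v, (β ⁻¹' {v}).Infinite := by
  obtain ⟨e⟩ : Nonempty (ℕ ≃ ℕ × V) := nonempty_equiv_of_countable
  refine ⟨fun n => (e n).2, fun v => ?_⟩
  refine Set.infinite_of_injective_forall_mem (f := fun n => e.symm (n, v)) ?_ (by simp)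
  intro a b hab
  simpa using hab

/-- A strategy whose number of queries and success probability are governed by the numbers of
possible images `k i` of vertices at level `i` and the sizes `m i` of the groups of vertices each
of which has to be hit. -/
theorem exists_strategy {H : SimpleGraph V} (p : I) {d Δ : ℕ} (hd : OutdegreeLE D d)
    (hDH : ∀ u v, H.Adj u v ↔ D.Adj u v ∨ D.Adj v u)
    (hlev : ∀ v w, D.Adj v w → lev w < lev v) (hΔ : ∀ v, lev v ≤ Δ)
    {k m : ℕ → ℕ} {M L K : ℕ} {δ : ℝ} (hδ0 : 0 ≤ δ)
    (hδ : δ * ((Fintype.card V + 1) * Fintype.card V) ≤ 1 / 2)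
    (hk : ∀ i j, i ≤ j → j ≤ Δ → k j ≤ k i) (hk1 : ∀ i ≤ Δ, 1 ≤ k i)
    (hL : ∀ i < Δ, k (i + 1) * m (i + 1) ≤ L)
    (hprobM : 2 ^ L * (1 - (p : ℝ) ^ (d - 1) / 2) ^ M ≤ δ)
    (hprobk : ∀ i < Δ,
      (1 - (1 - (1 - (p : ℝ)) ^ m (i + 1)) ^ (Fintype.card V * k (i + 1))) ^ k i ≤ δ)
    (hK : ∀ i < Δ, k i * (Fintype.card V * (k (i + 1) * m (i + 1))) ≤ K) :
    ∃ T : Strategy, T.cost ≤ Fintype.card V * (Fintype.card V * (M * d) + K) ∧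
      1 / 2 ≤ SimpleGraph.binomialRandom ℕ p {G | T.Finds H G} := by
  rcases isEmpty_or_nonempty V with hV | hV
  · have : ∀ G, Strategy.done.Finds H G := fun G =>
      ⟨⟨⟨fun v => (hV.false v).elim, fun {v} => (hV.false v).elim⟩, fun v => (hV.false v).elim⟩⟩
    exact ⟨.done, by simp [Strategy.cost], by simp [this]⟩
  have hp0 : (0 : ℝ) ≤ p := p.2.1
  have hp1 : (p : ℝ) ≤ 1 := p.2.2
  have hh : (1 : ℝ) ≤ Fintype.card V := by exact_mod_cast Fintype.card_pos
  have hδ1 : δ ≤ 1 := by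
    have h1 : (1 : ℝ) ≤ (Fintype.card V + 1) * Fintype.card V := by nlinarith
    linarith [mul_le_mul_of_nonneg_left h1 hδ0]
  obtain ⟨β, hβ⟩ := exists_infinite_fibers V
  have hinit : ∀ w, ∃ C : Finset ℕ, (∀ a ∈ C, β a = w) ∧ C.card = k (lev w) := by
    intro w
    obtain ⟨C, h1, h2⟩ := (hβ w).exists_subset_card_eq (k (lev w))
    exact ⟨C, fun a ha => h1 ha, h2⟩
  choose U hU using hinit
  set c := Fintype.card V * (M * d) + K with hc
  set q := (1 - δ) * (1 - δ) ^ Fintype.card V with hq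
  have hq0 : 0 ≤ q := mul_nonneg (by linarith) (pow_nonneg (by linarith) _)
  have hmain : ∀ n ≤ Fintype.card V, Achieves p ∅ ∅ (n * c) (q ^ n) fun F E => ∃ P x U,
      P.card = n ∧ IsPartialEmbedding D β (fun w => k (lev w)) P x U E ∧
        QueriedWithin D β P F := by
    intro n
    induction n with
    | zero =>
      intro _
      rw [zero_mul, pow_zero]
      -- Initially only the sinks are ready, and their reservoirs need no edges, so arbitrary
      -- vertices of their blocks serve.
      refine Achieves.of_goal ⟨∅, fun _ => 0, U, rfl, ⟨by simp, by simp, by simp, ?_, ?_, ?_⟩, ?_⟩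
      · exact fun w _ _ => (hU w).2.ge
      · exact fun w _ _ => (hU w).1
      · exact fun w _ h u _ y hy => absurd (h y hy) (by simp)
      · simp [QueriedWithin]
    | succ n ih =>
      intro hn
      refine ((ih (by omega)).bind hp0 hp1 hq0 ?_).mono (n := n * c + c) (q := q * q ^ n)
        (by rw [Nat.succ_mul]) (by rw [pow_succ'])
      rintro F E ⟨P, x, U, hP, h1, h2⟩
      subst hP
      exact achieves_extend hp0 hp1 hd hlev hΔ hβ hδ0 hδ1 hk hk1 hL hprobM hprobk hK
        (by omega) h1 h2
  obtain ⟨T, hT1, hT2, hT3⟩ := hmain _ le_rfl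
  refine ⟨T, hT1, ?_⟩
  rw [Strategy.binomialRandom_finds H p T hT2]
  have hhalf : (1 : ℝ) / 2 ≤ q ^ Fintype.card V := by
    rw [hq, ← pow_succ', ← pow_mul]
    -- Bernoulli's inequality over |V| steps with |V| + 1 factors each.
    have := one_add_mul_le_pow (show (-2 : ℝ) ≤ -δ by linarith)
      ((Fintype.card V + 1) * Fintype.card V)
    push_cast at this
    rw [← sub_eq_add_neg] at this
    linarith
  have hv := hhalf.trans (hT3.trans (Strategy.value_mono hp0 hp1
    (g' := fun _ E => H.IsContained (SimpleGraph.fromEdgeSet (E : Set (Sym2 ℕ))))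
    (fun F E ⟨P, x, U, hP, h1, _⟩ => isContained_of_isPartialEmbedding hDH hP h1) T ∅ ∅))
  calc (1 / 2 : ENNReal) = ENNReal.ofReal (1 / 2) := by
        rw [ENNReal.ofReal_div_of_pos (by norm_num)]; simp
    _ ≤ _ := ENNReal.ofReal_le_ofReal hv

theorem exists_queryComplexity_eq {V : Type*} {H : SimpleGraph V} {p : I} {T : Strategy}
    (hT : 1 / 2 ≤ SimpleGraph.binomialRandom ℕ p {G | T.Finds H G}) :
    ∃ N : ℕ, queryComplexity H p = N ∧ N ≤ T.cost := by
  have h : queryComplexity H p ≤ T.cost := iInf₂_le T hT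
  obtain ⟨N, hN, hle⟩ := ENat.le_natCast_iff.1 h
  exact ⟨N, hN, hle⟩

end Extension

/-- An orientation without long directed paths admits a bounded level function that decreases along
arcs. -/
theorem exists_level {V : Type*} {D : Digraph V} (hD : ∀ v, ¬ Relation.TransGen D.Adj v v)
    {r : ℕ} (hr : PathLengthLE D r) :
    ∃ lev : V → ℕ, (∀ v w, D.Adj v w → lev w < lev v) ∧ ∀ v, lev v ≤ r := by
  have hnodup : ∀ l : List V, l.IsChain D.Adj → l.Nodup := by
    intro l hl
    have h1 : l.IsChain (Relation.TransGen D.Adj) := hl.imp fun _ _ => Relation.TransGen.single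
    refine (List.isChain_iff_pairwise.1 h1).imp ?_
    rintro a b hab rfl
    exact hD a hab
  -- The lengths of directed paths starting at `v`; the level is the greatest of them. Acyclicity
  -- makes every chain a path.
  set S : V → Set ℕ := fun v => {n | ∃ l : List V, (v :: l).IsChain D.Adj ∧ l.length = n} with hS
  have hbound : ∀ v, ∀ n ∈ S v, n ≤ r := by
    rintro v n ⟨l, hl, rfl⟩
    simpa using hr _ hl (hnodup _ hl)
  have hbdd : ∀ v, BddAbove (S v) := fun v => ⟨r, hbound v⟩
  have hne : ∀ v, (S v).Nonempty := fun v => ⟨0, [], by simp, rfl⟩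
  refine ⟨fun v => sSup (S v), fun v w hvw => ?_, fun v => csSup_le (hne v) (hbound v)⟩
  obtain ⟨l, hl, hlen⟩ := Nat.sSup_mem (hne w) (hbdd w)
  rw [Nat.lt_iff_add_one_le]
  exact le_csSup (hbdd v) ⟨w :: l, List.isChain_cons_cons.2 ⟨hvw, hl⟩, by simp [hlen]⟩


/-! ### Asymptotic estimates -/

open Filter Topology

section Asymptotics

theorem tendsto_iterate_log_atTop (i : ℕ) : Tendsto Real.log^[i] atTop atTop :=
  Tendsto.iterate Real.tendsto_log_atTop i

theorem iterate_log_le_iterate_log {y : ℝ} {i j : ℕ} (hij : i ≤ j)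
    (h : ∀ l < j, 0 < Real.log^[l] y) : Real.log^[j] y ≤ Real.log^[i] y := by
  induction j, hij using Nat.le_induction with
  | base => exact le_rfl
  | succ j hij ih =>
    rw [Function.iterate_succ_apply']
    exact (Real.log_le_self (h j (by omega)).le).trans (ih fun l hl => h l (by omega))

/-- Holds because √s log s = o(s): exp(s/2) candidates outweigh a success chance of exp(-c √s log s)
each. -/
theorem eventually_le_exp_sub_sqrt_mul_log (c b : ℝ) (hc : 0 ≤ c) :
    ∀ᶠ s : ℝ in atTop, b ≤ Real.exp (s / 2 - c * (Real.sqrt s * Real.log s)) := by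
  have h1 : ∀ᶠ s : ℝ in atTop, ‖Real.log s‖ ≤ 1 / (4 * (c + 1)) * ‖s ^ (1 / 2 : ℝ)‖ :=
    (isLittleO_log_rpow_atTop (by norm_num : (0 : ℝ) < 1 / 2)).bound (by positivity)
  have h2 : Tendsto (fun s : ℝ => Real.exp (s / 4)) atTop atTop :=
    Real.tendsto_exp_atTop.comp (tendsto_id.atTop_div_const (by norm_num))
  filter_upwards [h1, h2.eventually_ge_atTop b, eventually_ge_atTop 1] with s hs hb hs1
  refine hb.trans (Real.exp_le_exp.2 ?_)
  rw [← Real.sqrt_eq_rpow, Real.norm_of_nonneg (Real.sqrt_nonneg s),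
    Real.norm_of_nonneg (Real.log_nonneg hs1)] at hs
  have h3 : Real.sqrt s * Real.log s ≤ 1 / (4 * (c + 1)) * s := by
    calc Real.sqrt s * Real.log s ≤ Real.sqrt s * (1 / (4 * (c + 1)) * Real.sqrt s) := by gcongr
      _ = 1 / (4 * (c + 1)) * (Real.sqrt s * Real.sqrt s) := by ring
      _ = _ := by rw [Real.mul_self_sqrt (by linarith)]
  have h4 : c * (Real.sqrt s * Real.log s) ≤ s / 4 := by
    calc c * (Real.sqrt s * Real.log s) ≤ (c + 1) * (1 / (4 * (c + 1)) * s) := by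
          gcongr
          · exact mul_nonneg (Real.sqrt_nonneg s) (Real.log_nonneg hs1)
          · linarith
      _ = s / 4 := by field_simp
  linarith

/-- The factor 4 in the hypothesis on `M` makes the power at most exp(-2r), which absorbs 2^L ≤ exp
r. -/
theorem two_pow_mul_one_sub_pow_le {p r : ℝ} (hp0 : 0 < p) (hp1 : p ≤ 1) {d L M : ℕ}
    (hL : L ≤ r) (hM : 4 * r * (1 / p) ^ (d - 1) ≤ M) :
    2 ^ L * (1 - p ^ (d - 1) / 2) ^ M ≤ Real.exp (-r) := by
  have h1 : (2 : ℝ) ^ L ≤ Real.exp L := by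
    rw [← mul_one (L : ℝ), Real.exp_nat_mul]
    exact pow_le_pow_left₀ (by norm_num) (by linarith [Real.add_one_le_exp 1]) _
  have hpd : p ^ (d - 1) ≤ 1 := pow_le_one₀ hp0.le hp1
  have hpd0 : 0 < p ^ (d - 1) := by positivity
  have h2 : (1 - p ^ (d - 1) / 2) ^ M ≤ Real.exp (M * -(p ^ (d - 1) / 2)) := by
    rw [Real.exp_nat_mul]
    exact pow_le_pow_left₀ (by linarith) (by linarith [Real.add_one_le_exp (-(p ^ (d - 1) / 2))]) _
  have h3 : 2 * r ≤ M * (p ^ (d - 1) / 2) := by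
    calc 2 * r = 4 * r * (1 / p) ^ (d - 1) * (p ^ (d - 1) / 2) := by
          rw [one_div, inv_pow]; field_simp; ring
      _ ≤ _ := by gcongr
  calc 2 ^ L * (1 - p ^ (d - 1) / 2) ^ M ≤ Real.exp L * Real.exp (M * -(p ^ (d - 1) / 2)) :=
        mul_le_mul h1 h2 (pow_nonneg (by linarith) _) (Real.exp_pos _).le
    _ = Real.exp (L + M * -(p ^ (d - 1) / 2)) := (Real.exp_add _ _).symm
    _ ≤ _ := Real.exp_le_exp.2 (by linarith)

theorem half_le_one_sub_one_sub_pow {p b : ℝ} (hp1 : p ≤ 1) (hb0 : 0 ≤ b) (hb1 : b ≤ 1)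
    {m : ℕ} (hm : b ≤ p * m) : b / 2 ≤ 1 - (1 - p) ^ m := by
  have h1 : (1 - p) ^ m ≤ Real.exp (-b) := by
    calc (1 - p) ^ m ≤ Real.exp (-p) ^ m :=
          pow_le_pow_left₀ (by linarith) (by linarith [Real.add_one_le_exp (-p)]) _
      _ = Real.exp (m * -p) := (Real.exp_nat_mul _ _).symm
      _ ≤ _ := Real.exp_le_exp.2 (by linarith)
  have h2 : Real.exp (-b) ≤ 1 / (1 + b) := by
    rw [Real.exp_neg, one_div]
    exact inv_anti₀ (by linarith) (by linarith [Real.add_one_le_exp b])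
  have h3 : 1 / (1 + b) ≤ 1 - b / 2 := by
    rw [div_le_iff₀ (by linarith)]
    nlinarith
  linarith

/-- Here π is the chance of hitting one group and n κ the number of groups. Since π ≥ s^{-3} and n κ
≤ 2c√s, all are hit with probability at least exp(-6c √s log s), so at least B of the `k` candidates
are expected to succeed. -/
theorem one_sub_pow_pow_le {s π c B : ℝ} (hs : 1 ≤ s) (hc : 0 ≤ c) {κ k : ℕ} (hπ1 : π ≤ 1)
    (hπ : (s ^ 3)⁻¹ ≤ π) {n : ℕ} (hn : n ≤ c) (hκ : κ ≤ 2 * Real.sqrt s)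
    (hk : Real.exp (s / 2) ≤ k)
    (hB : B ≤ Real.exp (s / 2 - 6 * c * (Real.sqrt s * Real.log s))) :
    (1 - π ^ (n * κ)) ^ k ≤ Real.exp (-B) := by
  have hs0 : 0 < s := by linarith
  have hlog : 0 ≤ Real.log s := Real.log_nonneg hs
  have hπ0 : 0 < π := lt_of_lt_of_le (by positivity) hπ
  have h1 : Real.exp (-(6 * c * (Real.sqrt s * Real.log s))) ≤ π ^ (n * κ) := by
    calc Real.exp (-(6 * c * (Real.sqrt s * Real.log s)))
        ≤ Real.exp ((n * κ : ℕ) * -(3 * Real.log s)) := by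
          refine Real.exp_le_exp.2 ?_
          have : (n : ℝ) * κ ≤ c * (2 * Real.sqrt s) := by gcongr
          push_cast
          nlinarith [mul_le_mul_of_nonneg_right this hlog]
      _ = ((s ^ 3)⁻¹) ^ (n * κ) := by
          rw [Real.exp_nat_mul, Real.exp_neg]
          congr 2
          rw [mul_comm, Real.exp_mul, Real.exp_log hs0]
          norm_cast
      _ ≤ _ := pow_le_pow_left₀ (by positivity) hπ _
  have h2 : B ≤ k * π ^ (n * κ) := by
    calc B ≤ Real.exp (s / 2) * Real.exp (-(6 * c * (Real.sqrt s * Real.log s))) := by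
          rw [← Real.exp_add, ← sub_eq_add_neg]; exact hB
      _ ≤ _ := mul_le_mul hk h1 (Real.exp_pos _).le (by positivity)
  have h3 : π ^ (n * κ) ≤ 1 := pow_le_one₀ hπ0.le hπ1
  calc (1 - π ^ (n * κ)) ^ k ≤ Real.exp (-π ^ (n * κ)) ^ k :=
        pow_le_pow_left₀ (by linarith) (by linarith [Real.add_one_le_exp (-π ^ (n * κ))]) _
    _ = Real.exp (k * -π ^ (n * κ)) := (Real.exp_nat_mul _ _).symm
    _ ≤ _ := Real.exp_le_exp.2 (by linarith)

theorem tendsto_exp_neg_div_log : Tendsto (fun y : ℝ => Real.exp (-(y / Real.log y))) atTop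
    (𝓝 0) := by
  refine Real.tendsto_exp_neg_atTop_nhds_zero.comp ?_
  have h : Tendsto (fun y : ℝ => Real.log y / y) atTop (𝓝[>] 0) := by
    refine tendsto_nhdsWithin_iff.2 ⟨?_, ?_⟩
    · simpa using Real.isLittleO_log_id_atTop.tendsto_div_nhds_zero
    · filter_upwards [eventually_gt_atTop 1] with y hy
      exact div_pos (Real.log_pos hy) (by linarith)
  exact h.inv_tendsto_nhdsGT_zero.congr fun y => by simp

theorem eventually_log_sq_le (c : ℝ) (hc : 0 < c) :
    ∀ᶠ y : ℝ in atTop, c * Real.log y ^ 2 ≤ y := by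
  have h := (isLittleO_log_rpow_atTop (by norm_num : (0 : ℝ) < 1 / 2)).bound
    (c := 1 / Real.sqrt c) (by positivity)
  filter_upwards [h, eventually_ge_atTop 1] with y hy hy1
  rw [← Real.sqrt_eq_rpow, Real.norm_of_nonneg (Real.sqrt_nonneg y),
    Real.norm_of_nonneg (Real.log_nonneg hy1)] at hy
  calc c * Real.log y ^ 2 ≤ c * (1 / Real.sqrt c * Real.sqrt y) ^ 2 := by
        have := Real.log_nonneg hy1
        gcongr
    _ = y := by
        rw [mul_pow, div_pow, Real.sq_sqrt hc.le, Real.sq_sqrt (by linarith)]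
        field_simp

end Asymptotics

/-! ### Choice of the parameters -/

section Parameters

variable {y : ℝ} {h d Δ : ℕ} {δ : ℝ}

/-- The numbers of possible images, sizes of groups, and batch sizes used for small `p = 1 / y`. -/
theorem exists_parameters (hd : 2 ≤ d) (hΔ : 1 ≤ Δ) (hδ : 0 < δ)
    (ht : ∀ i ≤ Δ + 1, 16 ≤ Real.log^[i] y)
    (hB : ∀ i ≤ Δ + 1, Real.log (1 / δ) ≤ Real.exp (Real.log^[i] y / 2 -
      6 * h * (Real.sqrt (Real.log^[i] y) * Real.log (Real.log^[i] y))))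
    (hy1 : Real.exp (-(y / Real.log y)) ≤ δ) (hy2 : 8 * Real.log y ^ 2 ≤ y)
    {p : ℝ} (hp : p = 1 / y) :
    ∃ (k m : ℕ → ℕ) (M L K : ℕ),
      (∀ i j, i ≤ j → j ≤ Δ → k j ≤ k i) ∧ (∀ i ≤ Δ, 1 ≤ k i) ∧
      (∀ i < Δ, k (i + 1) * m (i + 1) ≤ L) ∧
      2 ^ L * (1 - p ^ (d - 1) / 2) ^ M ≤ δ ∧
      (∀ i < Δ, (1 - (1 - (1 - p) ^ m (i + 1)) ^ (h * k (i + 1))) ^ k i ≤ δ) ∧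
      (∀ i < Δ, k i * (h * (k (i + 1) * m (i + 1))) ≤ K) ∧
      ((h * (h * (M * d) + K) : ℕ) : ℝ) ≤
        h ^ 2 * (5 * d + 2) * (y ^ d * Real.log^[Δ + 1] y / Real.log^[Δ] y) := by
  have ht0 : ∀ i ≤ Δ + 1, 0 < Real.log^[i] y := fun i hi => by linarith [ht i hi]
  have hyy : 16 ≤ y := ht 0 (by omega)
  have hy0 : 0 < y := by linarith
  have hp0 : 0 < p := by rw [hp]; positivity
  have hp1 : p ≤ 1 := by rw [hp, div_le_one hy0]; linarith
  have hanti : ∀ i j, i ≤ j → j ≤ Δ + 1 → Real.log^[j] y ≤ Real.log^[i] y := fun i j hij hj =>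
    iterate_log_le_iterate_log hij fun l hl => ht0 l (by omega)
  set τ := Real.log^[Δ] y with hτ
  have hτ16 : 16 ≤ τ := ht Δ (by omega)
  have hτ0 : 0 < τ := by linarith
  have hτlog : τ ≤ Real.log y := hanti 1 Δ hΔ (by omega)
  -- With s = log_{i+1} y this is about exp(s/2) at level i but only √s at level i+1. The square
  -- root is what keeps the cost √s log s of hitting √s groups below s/2.
  set k : ℕ → ℕ := fun i => ⌈Real.sqrt (Real.log^[i] y)⌉₊ with hk
  set L : ℕ := ⌊y / τ⌋₊ with hL
  have hL0 : (L : ℝ) ≤ y / τ := Nat.floor_le (by positivity)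
  have hL1 : y / τ < L + 1 := Nat.lt_floor_add_one _
  have hk1 : ∀ i ≤ Δ, 1 ≤ k i := fun i hi =>
    Nat.ceil_pos.2 (Real.sqrt_pos.2 (ht0 i (by omega)))
  have hkanti : ∀ i j, i ≤ j → j ≤ Δ → k j ≤ k i := fun i j hij hj =>
    Nat.ceil_le_ceil (Real.sqrt_le_sqrt (hanti i j hij (by omega)))
  have hk2 : ∀ i ≤ Δ + 1, (k i : ℝ) ≤ 2 * Real.sqrt (Real.log^[i] y) := by
    intro i hi
    have h1 : 1 ≤ Real.sqrt (Real.log^[i] y) := Real.one_le_sqrt.2 (by linarith [ht i hi])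
    have := Nat.ceil_lt_add_one (Real.sqrt_nonneg (Real.log^[i] y))
    simp only [hk]
    linarith
  have hmL : ∀ i, k i * (L / k i) ≤ L := fun i => Nat.mul_div_le L (k i)
  have hkL : ∀ i < Δ, k i * (h * (k (i + 1) * (L / k (i + 1)))) ≤ k 0 * (h * L) :=
    fun i hi => Nat.mul_le_mul (hkanti 0 i (by omega) hi.le) (Nat.mul_le_mul_left _ (hmL _))
  -- `M` is 4 (y/τ) y^(d-1), the number of trials that `two_pow_mul_one_sub_pow_le` requires for r =
  -- y/τ.
  refine ⟨k, fun i => L / k i, ⌈4 * y ^ d / τ⌉₊, L, k 0 * (h * L), hkanti, hk1,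
    fun i _ => hmL _, ?_, ?_, hkL, ?_⟩
  · refine (two_pow_mul_one_sub_pow_le hp0 hp1 hL0 ?_).trans
      (le_trans (Real.exp_le_exp.2 ?_) hy1)
    · refine le_trans (le_of_eq ?_) (Nat.le_ceil _)
      rw [hp, one_div_one_div]
      obtain ⟨e, rfl⟩ : ∃ e, d = e + 1 := ⟨d - 1, by omega⟩
      rw [Nat.add_sub_cancel, pow_succ]
      ring
    · exact neg_le_neg (by gcongr)
  · intro i hi
    set s := Real.log^[i + 1] y with hs
    have hs16 : 16 ≤ s := ht (i + 1) (by omega)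
    have hτs : τ ≤ s := hanti (i + 1) Δ hi (by omega)
    have hslog : s ≤ Real.log y := hanti 1 (i + 1) (by omega) (by omega)
    have hκ2 : (k (i + 1) : ℝ) ≤ 2 * Real.sqrt s := hk2 (i + 1) (by omega)
    have hsq : Real.sqrt s ≤ s := by
      rw [Real.sqrt_le_left (by linarith)]; nlinarith
    have hκs : (k (i + 1) : ℝ) ≤ 2 * s := by linarith
    set κ := k (i + 1) with hκ
    have hκ1 : (1 : ℝ) ≤ κ := by exact_mod_cast hk1 (i + 1) hi
    have hm : y / τ - 1 < κ * ((L / κ : ℕ) + 1) := by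
      have h1 : L < κ * (L / κ + 1) := Nat.lt_mul_div_succ L (hk1 (i + 1) hi)
      have h2 : (L : ℝ) + 1 ≤ κ * ((L / κ : ℕ) + 1) := by exact_mod_cast h1
      linarith
    have hτκ : τ * κ ≤ 2 * s ^ 2 := by nlinarith
    have hlarge : 4 * (τ * κ) ≤ y := by nlinarith
    -- Ideally p m = 1/(τκ); the two roundings, of y/τ and of L/κ, cost at most a factor 2 because y
    -- ≥ 4τκ.
    have hpm : 1 / (2 * (τ * κ)) ≤ p * (L / κ : ℕ) := by
      rw [hp, div_mul_eq_mul_div, one_mul, div_le_div_iff₀ (by positivity) hy0]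
      have : y < τ * (κ * ((L / κ : ℕ) + 1) + 1) := by
        rw [← div_lt_iff₀' hτ0]; linarith
      nlinarith [mul_le_mul_of_nonneg_left hκ1 hτ0.le]
    have hb1 : 1 / (2 * (τ * κ)) ≤ 1 := by
      rw [div_le_one (by positivity)]
      nlinarith [mul_le_mul_of_nonneg_left hκ1 hτ0.le]
    have hπ := half_le_one_sub_one_sub_pow hp1 (by positivity) hb1 hpm
    refine (one_sub_pow_pow_le (B := Real.log (1 / δ)) (c := h) (s := s) (by linarith)
      (by positivity) ?_ (le_trans ?_ hπ) le_rfl hκ2 ?_ (hB (i + 1) (by omega))).trans ?_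
    · linarith [pow_nonneg (sub_nonneg.2 hp1) (L / κ)]
    · rw [div_div, one_div]
      -- 4τκ ≤ 8s² ≤ s³, as s ≥ 16.
      refine inv_anti₀ (by positivity) ?_
      nlinarith [sq_nonneg s]
    · have : Real.exp (s / 2) = Real.sqrt (Real.log^[i] y) := by
        rw [Real.exp_half, hs, Function.iterate_succ_apply', Real.exp_log (ht0 i (by omega))]
      rw [this]
      exact Nat.le_ceil _
    · rw [one_div, Real.log_inv, neg_neg, Real.exp_log hδ]
  · have hyd : 0 < y ^ d / τ := by positivity
    have hyd2 : y ^ 2 ≤ y ^ d := pow_le_pow_right₀ (by linarith) hd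
    have hlogy : Real.log y ≤ y := Real.log_le_self hy0.le
    have hM : (⌈4 * y ^ d / τ⌉₊ : ℝ) ≤ 5 * (y ^ d / τ) := by
      have h1 := Nat.ceil_lt_add_one (show 0 ≤ 4 * y ^ d / τ by positivity)
      have h2 : 1 ≤ y ^ d / τ := by
        rw [one_le_div hτ0]; nlinarith
      have h3 : 4 * y ^ d / τ = 4 * (y ^ d / τ) := by ring
      linarith
    have hkL : (k 0 : ℝ) * L ≤ 2 * (y ^ d / τ) := by
      have hsq : Real.sqrt y ≤ y := by
        rw [Real.sqrt_le_left (by linarith)]; nlinarith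
      have h0 : (k 0 : ℝ) ≤ 2 * Real.sqrt y := hk2 0 (by omega)
      calc (k 0 : ℝ) * L ≤ (2 * y) * (y / τ) := by gcongr; linarith
        _ = 2 * (y ^ 2 / τ) := by ring
        _ ≤ _ := by gcongr
    -- The factor log_{Δ+1} y enters only here: the cost is already O(y^d/τ).
    have h1 : 1 ≤ Real.log^[Δ + 1] y := by linarith [ht (Δ + 1) le_rfl]
    calc ((h * (h * (⌈4 * y ^ d / τ⌉₊ * d) + k 0 * (h * L)) : ℕ) : ℝ)
        = h ^ 2 * (⌈4 * y ^ d / τ⌉₊ * d + k 0 * L) := by push_cast; ring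
      _ ≤ h ^ 2 * (5 * (y ^ d / τ) * d + 2 * (y ^ d / τ)) := by gcongr
      _ = h ^ 2 * (5 * d + 2) * (y ^ d / τ * 1) := by ring
      _ ≤ h ^ 2 * (5 * d + 2) * (y ^ d / τ * Real.log^[Δ + 1] y) := by gcongr
      _ = _ := by ring

theorem eventually_parameter_bounds (h Δ : ℕ) {δ : ℝ} (hδ : 0 < δ) :
    ∀ᶠ y : ℝ in atTop, (∀ i ≤ Δ + 1, 16 ≤ Real.log^[i] y) ∧
      (∀ i ≤ Δ + 1, Real.log (1 / δ) ≤ Real.exp (Real.log^[i] y / 2 -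
        6 * h * (Real.sqrt (Real.log^[i] y) * Real.log (Real.log^[i] y)))) ∧
      Real.exp (-(y / Real.log y)) ≤ δ ∧ 8 * Real.log y ^ 2 ≤ y := by
  have h1 : ∀ᶠ y : ℝ in atTop, ∀ i ∈ Set.Iic (Δ + 1), 16 ≤ Real.log^[i] y :=
    (eventually_all_finite (Set.finite_Iic _)).2 fun i _ =>
      (tendsto_iterate_log_atTop i).eventually_ge_atTop 16
  have h2 : ∀ᶠ y : ℝ in atTop, ∀ i ∈ Set.Iic (Δ + 1), Real.log (1 / δ) ≤
      Real.exp (Real.log^[i] y / 2 -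
        6 * h * (Real.sqrt (Real.log^[i] y) * Real.log (Real.log^[i] y))) :=
    (eventually_all_finite (Set.finite_Iic _)).2 fun i _ =>
      (tendsto_iterate_log_atTop i).eventually
        (eventually_le_exp_sub_sqrt_mul_log (6 * h) _ (by positivity))
  filter_upwards [h1, h2, tendsto_exp_neg_div_log.eventually (eventually_le_nhds hδ),
    eventually_log_sq_le 8 (by norm_num)] with y h1 h2 h3 h4
  exact ⟨h1, h2, h3, h4⟩

end Parameters

/-! ### The bounds on the query complexity -/

theorem tendsto_iterate_log_succ_div (Δ : ℕ) :
    Tendsto (fun y => Real.log^[Δ + 1] y / Real.log^[Δ] y) atTop (𝓝 0) := by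
  have h : Tendsto (fun y : ℝ => Real.log y / y) atTop (𝓝 0) := by
    simpa using Real.isLittleO_log_id_atTop.tendsto_div_nhds_zero
  simpa only [Function.comp_def, Function.iterate_succ_apply'] using
    h.comp (tendsto_iterate_log_atTop Δ)

theorem exists_queryComplexity_le {V : Type*} [Fintype V] {H : SimpleGraph V} {D : Digraph V}
    {d Δ : ℕ} (hDH : IsAcyclicOrientation D H) (hd : OutdegreeLE D d) (hr : PathLengthLE D Δ)
    (hd2 : 2 ≤ d) (hΔ1 : 1 ≤ Δ) :
    ∀ᶠ y : ℝ in atTop, ∀ p : I, (p : ℝ) = 1 / y → ∃ N : ℕ, queryComplexity H p = N ∧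
      (N : ℝ) ≤ Fintype.card V ^ 2 * (5 * d + 2) *
        (y ^ d * Real.log^[Δ + 1] y / Real.log^[Δ] y) := by
  obtain ⟨lev, hlev, hΔ⟩ := exists_level hDH.2 hr
  set h := Fintype.card V with hh
  have hδ : (0 : ℝ) < 1 / (2 * (h + 1) ^ 2) := by positivity
  filter_upwards [eventually_parameter_bounds h Δ hδ] with y ⟨ht, hB, hy1, hy2⟩ p hp
  obtain ⟨k, m, M, L, K, h1, h2, h3, h4, h5, h6, h7⟩ :=
    exists_parameters (d := d) hd2 hΔ1 hδ ht hB hy1 hy2 hp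
  obtain ⟨T, hT, hT'⟩ := exists_strategy p hd hDH.1 hlev hΔ hδ.le (by
    rw [div_mul_eq_mul_div, div_le_div_iff₀ (by positivity) (by norm_num)]
    nlinarith [(Nat.cast_nonneg h : (0 : ℝ) ≤ h)]) h1 h2 h3 h4 h5 h6
  obtain ⟨N, hN, hNT⟩ := exists_queryComplexity_eq hT'
  exact ⟨N, hN, le_trans (by exact_mod_cast hNT.trans hT) h7⟩

theorem exists_threshold_of_eventually {Q : ℝ → Prop} (h : ∀ᶠ y : ℝ in atTop, Q y) :
    ∃ p₀ > (0 : ℝ), ∀ p : ℝ, 0 < p → p < p₀ → Q (1 / p) := by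
  obtain ⟨Y, hY⟩ := eventually_atTop.1 h
  refine ⟨1 / max Y 1, by positivity, fun p hp hp0 => hY _ ?_⟩
  rw [lt_one_div hp (by positivity)] at hp0
  exact (le_max_left Y 1).trans hp0.le

theorem queryComplexity_bounds_of_orientation {V : Type*} [Fintype V] {H : SimpleGraph V}
    {D : Digraph V} {d Δ : ℕ} (hDH : IsAcyclicOrientation D H) (hDd : OutdegreeLE D d)
    (hDr : PathLengthLE D Δ) (hd2 : 2 ≤ d) (hΔ1 : 1 ≤ Δ) :
    (∃ C > (0 : ℝ), ∃ p₀ > (0 : ℝ), ∀ p : unitInterval, 0 < (p : ℝ) → (p : ℝ) < p₀ →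
      ∃ N : ℕ, queryComplexity H p = N ∧
        (N : ℝ) ≤ C * ((1 / (p : ℝ)) ^ d *
          Real.log^[Δ + 1] (1 / (p : ℝ)) / Real.log^[Δ] (1 / (p : ℝ)))) ∧
    (∀ ε > (0 : ℝ), ∃ p₁ > (0 : ℝ), ∀ p : unitInterval, 0 < (p : ℝ) → (p : ℝ) < p₁ →
      ∃ N : ℕ, queryComplexity H p = N ∧
        (N : ℝ) ≤ ε * (1 / (p : ℝ)) ^ d) := by
  have hmain := exists_queryComplexity_le hDH hDd hDr hd2 hΔ1
  have hpos : ∀ᶠ y : ℝ in atTop, 0 < Real.log^[Δ + 1] y / Real.log^[Δ] y := by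
    filter_upwards [(tendsto_iterate_log_atTop (Δ + 1)).eventually_gt_atTop 0,
      (tendsto_iterate_log_atTop Δ).eventually_gt_atTop 0] with y h1 h2 using div_pos h1 h2
  set A : ℝ := Fintype.card V ^ 2 * (5 * d + 2) with hA
  have hA0 : 0 ≤ A := by positivity
  constructor
  · obtain ⟨p₀, hp₀, h⟩ := exists_threshold_of_eventually
      ((hmain.and hpos).and (eventually_gt_atTop 0))
    -- `A` vanishes when H has no vertices, while the constant must be positive.
    refine ⟨A + 1, by positivity, p₀, hp₀, fun p hp hpp => ?_⟩
    obtain ⟨⟨h1, h2⟩, h3⟩ := h p hp hpp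
    obtain ⟨N, hN, hle⟩ := h1 p (by rw [one_div_one_div])
    refine ⟨N, hN, hle.trans ?_⟩
    rw [mul_div_assoc]
    gcongr
    linarith
  · intro ε hε
    have hsmall : ∀ᶠ y : ℝ in atTop, A * (Real.log^[Δ + 1] y / Real.log^[Δ] y) ≤ ε := by
      have := (tendsto_iterate_log_succ_div Δ).const_mul A
      rw [mul_zero] at this
      exact this.eventually (eventually_le_nhds hε)
    obtain ⟨p₀, hp₀, h⟩ := exists_threshold_of_eventually (hmain.and hsmall)
    refine ⟨p₀, hp₀, fun p hp hpp => ?_⟩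
    obtain ⟨h1, h2⟩ := h p hp hpp
    obtain ⟨N, hN, hle⟩ := h1 p (by rw [one_div_one_div])
    refine ⟨N, hN, hle.trans ?_⟩
    calc A * ((1 / (p : ℝ)) ^ d * Real.log^[Δ + 1] (1 / (p : ℝ)) / Real.log^[Δ] (1 / (p : ℝ)))
        = A * (Real.log^[Δ + 1] (1 / (p : ℝ)) / Real.log^[Δ] (1 / (p : ℝ))) *
            (1 / (p : ℝ)) ^ d := by ring
      _ ≤ _ := by gcongr

end SubgraphQuery

theorem theorem1 {V : Type*} [Finite V] (H : SimpleGraph V) (d Δ : ℕ)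
    (hd : SubgraphQuery.degeneracy H = d) (hd2 : 2 ≤ d)
    (hΔ : SubgraphQuery.depth H = Δ) (hΔ1 : 1 ≤ Δ) :
    (∃ C > (0 : ℝ), ∃ p₀ > (0 : ℝ), ∀ p : unitInterval, 0 < (p : ℝ) → (p : ℝ) < p₀ →
      ∃ N : ℕ, SubgraphQuery.queryComplexity H p = N ∧
        (N : ℝ) ≤ C * ((1 / (p : ℝ)) ^ d *
          Real.log^[Δ + 1] (1 / (p : ℝ)) / Real.log^[Δ] (1 / (p : ℝ)))) ∧
    (∀ ε > (0 : ℝ), ∃ p₁ > (0 : ℝ), ∀ p : unitInterval, 0 < (p : ℝ) → (p : ℝ) < p₁ →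
      ∃ N : ℕ, SubgraphQuery.queryComplexity H p = N ∧
        (N : ℝ) ≤ ε * (1 / (p : ℝ)) ^ d) := by
  have := Fintype.ofFinite V
  -- The infimum of the empty set is 0, so positive depth guarantees that an orientation attaining
  -- it exists.
  have hmem := Nat.sInf_mem (Nat.nonempty_of_pos_sInf (show 0 < SubgraphQuery.depth H by omega))
  change SubgraphQuery.depth H ∈ _ at hmem
  rw [hΔ, hd] at hmem
  obtain ⟨D, hDH, hDd, hDr⟩ := hmem
  exact SubgraphQuery.queryComplexity_bounds_of_orientation hDH hDd hDr hd2 hΔ1
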